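/- Let $n\ge 1$ and $\delta>0$. For $k=(k_1,\dots,k_{2n})$, $a=(a_1,\dots,a_{2n})$, $c=(c_1,\dots,c_{2n})\in\mathbb C^{2n}$ and $\xi\in\mathbb R$ put, for $x\in\mathbb C$ and $t\in\mathbb R$, $$L_j=i\,(e^{-2i\delta k_j}-1),\qquad \lambda_j=\lambda_j(x,t)=(k_j-L_j)\xi+k_jx+ik_j^2t+a_j ,$$ and for $0\le m\le 2n$ let $D_m(x,t)$ be the determinant of the $2n\times 2n$ matrix whose $j$-th row is $$\bigl(c_je^{\lambda_j},\;k_jc_je^{\lambda_j},\;\dots,\;k_j^{m-1}c_je^{\lambda_j},\;1,\;L_j,\;\dots,\;L_j^{2n-m-1}\bigr).$$ Let $\tau=D_n$ and $w_{21}(x,t)=(-1)^{n+1}D_{n-1}(x,t)/D_n(x,t)$. Consider the conditions * C1: $\overline{k_j}=-k_{n+j}$ and $\overline{a_j}=-a_{n+j}$ for $1\le j\le n$ (and $\xi$ is real); * C2: $\dfrac{\pi}{2\delta}>\operatorname{Re}k_1>\operatorname{Re}k_2>\dots>\operatorname{Re}k_n>0$; * C3: for $1\le j\le n$, $\displaystyle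 c_j=\prod_{r=1}^n\frac{L_j-L_{n+r}}{k_j-k_{n+r}}$ and $\displaystyle c_{n+j}=-\prod_{1\le r\le n,\ r\ne j}\frac{L_{n+j}-L_{n+r}}{k_{n+j}-k_{n+r}}$. There is a number $\varepsilon>0$, depending only on $n$ and $\delta$, such that for all $k,a,c,\xi$ satisfying C1, C2 and C3 the following holds. 1. For every $t\in\mathbb R$, $w_{21}(x-i\delta,t)\to0$ as $x\to+\infty$ and as $x\to-\infty$ along the real axis. 2. If in addition $|k_j|<\varepsilon$ for all $j$, then * for every $t\in\mathbb R$, $\tau(z-i\delta,t)\neq0$ for all $z$ with $0\le\operatorname{Im}z\le2\delta$, and $z\mapsto w_{21}(z-i\delta,t)$ satisfies the analyticity condition: it is analytic everywhere in the closed strip $0\le\operatorname{Im}z\le2\delta$ and integrable on the real axis; * $u(x,t)=w_{21}(x-i\delta,t)$ is a classical solution, for all real $x$ and $t$, of the nonlocal focusing INLS equation $$iu_t=u_{xx}-u\,(T+i)(|u|^2)_x,\qquad T[f](x)=\mathrm{p.v.}\!\int_{-\infty}^{\infty}\frac1{2\delta}\coth\Bigl[\frac{\pi}{2\delta}(y-x)\Bigr]f(y)\,dy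 ,$$ where the principal value defining $T[(|u|^2)_x](x)$ exists (so that, by 1, $u$ is a bright $n$-soliton solution). -/

import Mathlib

open MeasureTheory Filter Topology

/-!
Indices `1, …, 2n` are modelled by `Fin (n + n)`: for `j : Fin n`, the index `j` is
`Fin.castAdd n j` and the index `n + j` is `Fin.natAdd n j`.
-/

namespace INLS

noncomputable section

/-- `L = i (exp (-2 i δ k) - 1)`. -/
def bigL (δ : ℝ) (k : ℂ) : ℂ :=
  Complex.I * (Complex.exp (-2 * Complex.I * δ * k) - 1)

/-- The phase `λ = (k - L) ξ + k x + i k² t + a`, as a function of complex `x` and real `t`. -/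
def phase (δ ξ : ℝ) (k a : ℂ) (x : ℂ) (t : ℝ) : ℂ :=
  (k - bigL δ k) * ξ + k * x + Complex.I * k ^ 2 * t + a

/-- The double-Wronskian matrix whose `j`-th row is
`(c_j e^{λ_j}, k_j c_j e^{λ_j}, …, k_j^{m-1} c_j e^{λ_j}, 1, L_j, …, L_j^{2n-m-1})`. -/
def wronskiMatrix {n : ℕ} (m : ℕ) (δ ξ : ℝ) (k a c : Fin (n + n) → ℂ) (x : ℂ) (t : ℝ) :
    Matrix (Fin (n + n)) (Fin (n + n)) ℂ :=
  Matrix.of fun j q =>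
    if (q : ℕ) < m then k j ^ (q : ℕ) * (c j * Complex.exp (phase δ ξ (k j) (a j) x t))
    else bigL δ (k j) ^ ((q : ℕ) - m)

/-- The denominator `τ` of `w₂₁`: `n` exponential columns and `n` columns `1, L, …, L^{n-1}`. -/
def tau {n : ℕ} (δ ξ : ℝ) (k a c : Fin (n + n) → ℂ) (x : ℂ) (t : ℝ) : ℂ :=
  (wronskiMatrix n δ ξ k a c x t).det

/-- The double-Wronskian ratio `w₂₁`; the numerator has `n - 1` exponential columns and the
`n + 1` columns `1, L, …, L^n` (it is used for `1 ≤ n` only). -/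
def w21 {n : ℕ} (δ ξ : ℝ) (k a c : Fin (n + n) → ℂ) (x : ℂ) (t : ℝ) : ℂ :=
  (-1) ^ (n + 1) * (wronskiMatrix (n - 1) δ ξ k a c x t).det / tau δ ξ k a c x t

/-- The conditions C1, C2, C3 on the parameters. -/
structure SolitonParameters {n : ℕ} (δ : ℝ) (k a c : Fin (n + n) → ℂ) : Prop where
  conj_k : ∀ j : Fin n, star (k (Fin.castAdd n j)) = -k (Fin.natAdd n j)
  conj_a : ∀ j : Fin n, star (a (Fin.castAdd n j)) = -a (Fin.natAdd n j)
  re_lt : ∀ j : Fin n, (k (Fin.castAdd n j)).re < Real.pi / (2 * δ)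
  re_pos : ∀ j : Fin n, 0 < (k (Fin.castAdd n j)).re
  re_anti : ∀ i j : Fin n, i < j → (k (Fin.castAdd n j)).re < (k (Fin.castAdd n i)).re
  c_left : ∀ j : Fin n, c (Fin.castAdd n j) =
    ∏ r : Fin n, (bigL δ (k (Fin.castAdd n j)) - bigL δ (k (Fin.natAdd n r))) /
      (k (Fin.castAdd n j) - k (Fin.natAdd n r))
  c_right : ∀ j : Fin n, c (Fin.natAdd n j) =
    -∏ r ∈ Finset.univ.erase j, (bigL δ (k (Fin.natAdd n j)) - bigL δ (k (Fin.natAdd n r))) /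
      (k (Fin.natAdd n j) - k (Fin.natAdd n r))

/-- The analyticity condition: `G` is analytic everywhere in the closed strip
`0 ≤ Im z ≤ 2δ` and is integrable on the real axis. -/
def AnalyticityCondition (δ : ℝ) (G : ℂ → ℂ) : Prop :=
  AnalyticOnNhd ℂ G {z | 0 ≤ z.im ∧ z.im ≤ 2 * δ} ∧ Integrable (fun x : ℝ => G x)

/-- The integrand `(1 / 2δ) coth (π (y - x) / 2δ) f(y)` of the transform `T`. -/
def cothIntegrand (δ : ℝ) (f : ℝ → ℝ) (x y : ℝ) : ℝ :=
  1 / (2 * δ) * (Real.cosh (Real.pi / (2 * δ) * (y - x)) /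
    Real.sinh (Real.pi / (2 * δ) * (y - x))) * f y

/-- `T[f](x)` exists as a Cauchy principal value and is equal to `l`. -/
def HasT (δ : ℝ) (f : ℝ → ℝ) (x l : ℝ) : Prop :=
  (∀ η : ℝ, 0 < η → IntegrableOn (cothIntegrand δ f x) {y | η < |y - x|}) ∧
  Tendsto (fun η : ℝ => ∫ y in {y | η < |y - x|}, cothIntegrand δ f x y) (𝓝[>] 0) (𝓝 l)

/-- `u = u(x, t)` is a classical solution of `i u_t = u_xx - u (T + i) (|u|²)_x` on `ℝ × ℝ`.
Here `ut, ux, uxx` are the partial derivatives of `u`, `rhox = (|u|²)_x` and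
`Trhox = T[(|u|²)_x]`, all of which are required to exist. -/
def IsSolution (δ : ℝ) (u : ℝ → ℝ → ℂ) : Prop :=
  ∃ (ut ux uxx : ℝ → ℝ → ℂ) (rhox Trhox : ℝ → ℝ → ℝ), ∀ x t : ℝ,
    HasDerivAt (fun s => u x s) (ut x t) t ∧
    HasDerivAt (fun y => u y t) (ux x t) x ∧
    HasDerivAt (fun y => ux y t) (uxx x t) x ∧
    HasDerivAt (fun y => ‖u y t‖ ^ 2) (rhox x t) x ∧
    HasT δ (fun y => rhox y t) x (Trhox x t) ∧
    Complex.I * ut x t = uxx x t - u x t * ((Trhox x t : ℂ) + Complex.I * (rhox x t : ℂ))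

end

end INLS

/-! A vector in the kernel of the matrix behind `tau` is a pair of polynomials `(A, B)` of degree
below `n` with `A(k_j) E_j + B(L_j) = 0` at all `2n` nodes, where `E_j = c_j e^{λ_j}`. So `tau ≠ 0`
says that such a pair vanishes, and then there are unique normalized pairs in which one member is
monic of degree `n`: `coeffP` if it is the first, `coeffQ` if it is the second. By Cramer's rule
`w21` is the top coefficient `v` of the first member of the `coeffQ` pair (`coeffQ_top`).

Differentiation in `x` multiplies `E_j` by `k_j`, differentiation in `t` by `i k_j²`, and the shift
by `-2iδ` by `1 - i L_j`. Combinations of the transformed pairs whose degrees drop below `n` must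
vanish. With `p` the subleading coefficient of the monic member of the `coeffP` pair and `w` the top
coefficient of its other member, this gives `i v_t = v_xx - 2 v p_x` (`evolution_equation`) and
`p(x+iδ) - p(x-iδ) + i w(x+iδ) v(x-iδ) = 0` (`shift_relation`). The symmetry of the nodes under `z ↦
-conj z` gives `w(x+iδ) = conj v(x-iδ)` (`star_coeff_eq`). Hence `(|u|²)_x = F(x) - F(x+2iδ)` with
`F(z) = -i p_x(z-iδ)`. A contour integral shows that `T` sends this to `i (F(x) + F(x+2iδ))`
(`exists_hasT`), so `(T+i)(|u|²)_x = 2iF = 2p_x(x-iδ)`, and the evolution equation becomes the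
nonlocal one.

Nonvanishing of `tau` at imaginary part `s`: Lagrange interpolation turns a kernel pair into vectors
`α`, `β` for which the Cauchy form of `α` with kernel `1/(conj k_l + k_j)`, twisted by `e^{2isk_j}`,
equals minus the Cauchy form of `β` with `L` in place of `k` (`det_pairMatrix_ne_zero_of_twisted`).
Cauchy forms are Gram forms of exponentials, hence positive. The twisted form keeps a positive real
part when the `k_j` are small, uniformly in how close they are to each other
(`exists_twisted_cauchy_re_pos`); this is the only place where `ε` is needed.

Decay as `x → ±∞` needs no smallness. After the rows with growing exponentials are divided by them,
the limiting system decouples into interpolation problems at `n` nodes each, which are nonsingular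
and have `v = 0` (`exists_two_sided_decay`). -/

namespace INLS

noncomputable section

open Polynomial Matrix

variable {n : ℕ}

/-! ### Double Wronskians and pairs of interpolating polynomials -/

/-- The polynomial of degree less than `n` with coefficients `c`. -/
def ofCoeffs (c : Fin n → ℂ) : ℂ[X] := ∑ q, C (c q) * X ^ (q : ℕ)

lemma degree_ofCoeffs_lt (c : Fin n → ℂ) : (ofCoeffs c).degree < n := by
  refine (Polynomial.degree_sum_le _ _).trans_lt ?_
  refine (Finset.sup_lt_iff (WithBot.bot_lt_coe n)).2 fun q _ => ?_
  exact (degree_C_mul_X_pow_le _ _).trans_lt (Nat.cast_lt.2 q.2)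

lemma eval_ofCoeffs (c : Fin n → ℂ) (x : ℂ) : (ofCoeffs c).eval x = ∑ q, c q * x ^ (q : ℕ) := by
  simp [ofCoeffs, eval_finsetSum]

lemma coeff_ofCoeffs (c : Fin n → ℂ) (q : Fin n) : (ofCoeffs c).coeff q = c q := by
  simp [ofCoeffs, finsetSum_coeff, coeff_X_pow, Fin.val_inj]

lemma ofCoeffs_eq_self {P : ℂ[X]} (hP : P.degree < n) :
    ofCoeffs (fun q : Fin n => P.coeff q) = P := by
  ext m
  by_cases hm : m < n
  · exact coeff_ofCoeffs _ ⟨m, hm⟩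
  · rw [coeff_eq_zero_of_degree_lt, coeff_eq_zero_of_degree_lt]
    · exact hP.trans_le (by exact_mod_cast not_lt.1 hm)
    · exact (degree_ofCoeffs_lt _).trans_le (by exact_mod_cast not_lt.1 hm)

/-- The matrix whose `j`-th row is
`(E_j, K_j E_j, …, K_j^{m-1} E_j, F_j, Λ_j F_j, …, Λ_j^{2n-m-1} F_j)`. -/
def pairMatrix (m : ℕ) (K Λ E F : Fin (n + n) → ℂ) : Matrix (Fin (n + n)) (Fin (n + n)) ℂ :=
  Matrix.of fun j q => if (q : ℕ) < m then K j ^ (q : ℕ) * E j else Λ j ^ ((q : ℕ) - m) * F j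

lemma wronskiMatrix_eq (m : ℕ) (δ ξ : ℝ) (k a c : Fin (n + n) → ℂ) (x : ℂ) (t : ℝ) :
    wronskiMatrix m δ ξ k a c x t = pairMatrix m k (fun j => bigL δ (k j))
      (fun j => c j * Complex.exp (phase δ ξ (k j) (a j) x t)) 1 := by
  ext j q
  simp [wronskiMatrix, pairMatrix]

lemma pairMatrix_mulVec (K Λ E F v : Fin (n + n) → ℂ) (j : Fin (n + n)) :
    (pairMatrix n K Λ E F *ᵥ v) j =
      (ofCoeffs fun q => v (Fin.castAdd n q)).eval (K j) * E j +
        (ofCoeffs fun q => v (Fin.natAdd n q)).eval (Λ j) * F j := by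
  rw [Matrix.mulVec, dotProduct, Fin.sum_univ_add, eval_ofCoeffs, eval_ofCoeffs, Finset.sum_mul,
    Finset.sum_mul]
  congr 1 <;> refine Finset.sum_congr rfl fun q _ => ?_
  · simp [pairMatrix]; ring
  · simp [pairMatrix]; ring

/-- Splitting a vector into halves reads it as the coefficients of a pair of polynomials. All later
algebraic identities use this criterion as a uniqueness principle. -/
lemma det_pairMatrix_ne_zero_iff (K Λ E F : Fin (n + n) → ℂ) :
    (pairMatrix n K Λ E F).det ≠ 0 ↔ ∀ A B : ℂ[X], A.degree < n → B.degree < n →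
      (∀ j, A.eval (K j) * E j + B.eval (Λ j) * F j = 0) → A = 0 ∧ B = 0 := by
  constructor
  · intro hdet A B hA hB h
    set v : Fin (n + n) → ℂ := Fin.append (fun q => A.coeff q) (fun q => B.coeff q) with hv
    have h1 : pairMatrix n K Λ E F *ᵥ v = 0 := by
      ext j
      rw [pairMatrix_mulVec]
      simpa [-Fin.natAdd_eq_addNat, hv, ofCoeffs_eq_self hA, ofCoeffs_eq_self hB] using h j
    have h2 : v = 0 := Matrix.eq_zero_of_mulVec_eq_zero hdet h1
    constructor
    · rw [← ofCoeffs_eq_self hA]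
      have : (fun q : Fin n => A.coeff q) = 0 := by
        ext q; simpa [hv] using congrFun h2 (Fin.castAdd n q)
      rw [this]; simp [ofCoeffs]
    · rw [← ofCoeffs_eq_self hB]
      have : (fun q : Fin n => B.coeff q) = 0 := by
        ext q; simpa [-Fin.natAdd_eq_addNat, hv] using congrFun h2 (Fin.natAdd n q)
      rw [this]; simp [ofCoeffs]
  · intro h hdet
    obtain ⟨v, hv0, hv⟩ := Matrix.exists_mulVec_eq_zero_iff.2 hdet
    obtain ⟨hA, hB⟩ := h _ _ (degree_ofCoeffs_lt fun q => v (Fin.castAdd n q))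
      (degree_ofCoeffs_lt fun q => v (Fin.natAdd n q))
      (fun j => by rw [← pairMatrix_mulVec, hv]; rfl)
    apply hv0
    ext j
    refine Fin.addCases (fun q => ?_) (fun q => ?_) j
    · rw [← coeff_ofCoeffs (fun q => v (Fin.castAdd n q)) q, hA]; simp
    · rw [← coeff_ofCoeffs (fun q => v (Fin.natAdd n q)) q, hB]; simp

/-- Coefficients (below the leading one) of the pair `(P, Q)` with `P` monic of degree `n`,
`deg Q < n` and `P(K_j) E_j + Q(Λ_j) F_j = 0`. -/
def coeffP (K Λ E F : Fin (n + n) → ℂ) : Fin (n + n) → ℂ :=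
  (pairMatrix n K Λ E F)⁻¹ *ᵥ fun j => -(K j ^ n * E j)

/-- Coefficients (below the leading one) of the pair `(P, Q)` with `deg P < n`, `Q` monic of
degree `n` and `P(K_j) E_j + Q(Λ_j) F_j = 0`. -/
def coeffQ (K Λ E F : Fin (n + n) → ℂ) : Fin (n + n) → ℂ :=
  (pairMatrix n K Λ E F)⁻¹ *ᵥ fun j => -(Λ j ^ n * F j)

lemma coeffP_spec {K Λ E F : Fin (n + n) → ℂ} (h : (pairMatrix n K Λ E F).det ≠ 0)
    (j : Fin (n + n)) :
    (X ^ n + ofCoeffs fun q => coeffP K Λ E F (Fin.castAdd n q)).eval (K j) * E j +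
      (ofCoeffs fun q => coeffP K Λ E F (Fin.natAdd n q)).eval (Λ j) * F j = 0 := by
  have h1 := congrFun (Matrix.mulVec_mulVec (fun j => -(K j ^ n * E j)) (pairMatrix n K Λ E F)
    (pairMatrix n K Λ E F)⁻¹) j
  rw [Matrix.mul_nonsing_inv _ (isUnit_iff_ne_zero.2 h), Matrix.one_mulVec, ← coeffP,
    pairMatrix_mulVec] at h1
  rw [eval_add, add_mul, eval_pow, eval_X, add_assoc, h1]
  ring

lemma coeffQ_spec {K Λ E F : Fin (n + n) → ℂ} (h : (pairMatrix n K Λ E F).det ≠ 0)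
    (j : Fin (n + n)) :
    (ofCoeffs fun q => coeffQ K Λ E F (Fin.castAdd n q)).eval (K j) * E j +
      (X ^ n + ofCoeffs fun q => coeffQ K Λ E F (Fin.natAdd n q)).eval (Λ j) * F j = 0 := by
  have h1 := congrFun (Matrix.mulVec_mulVec (fun j => -(Λ j ^ n * F j)) (pairMatrix n K Λ E F)
    (pairMatrix n K Λ E F)⁻¹) j
  rw [Matrix.mul_nonsing_inv _ (isUnit_iff_ne_zero.2 h), Matrix.one_mulVec, ← coeffQ,
    pairMatrix_mulVec] at h1
  rw [eval_add, add_mul, eval_pow, eval_X]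
  linear_combination h1

lemma pairMatrix_smul (m : ℕ) (K Λ E F s : Fin (n + n) → ℂ) :
    pairMatrix m K Λ (s * E) (s * F) = Matrix.diagonal s * pairMatrix m K Λ E F := by
  ext j q
  simp only [pairMatrix, Matrix.diagonal_mul, Matrix.of_apply, Pi.mul_apply]
  split_ifs <;> ring

/-- Multiplying the `j`-th row by a nonzero number does not change the equation it expresses. This
lets growing exponentials be traded for decaying ones when `x → ±∞`. -/
lemma coeff_smul (K Λ E F s : Fin (n + n) → ℂ) (hs : ∀ j, s j ≠ 0) :
    coeffP K Λ (s * E) (s * F) = coeffP K Λ E F ∧ coeffQ K Λ (s * E) (s * F) = coeffQ K Λ E F := by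
  have hdet : IsUnit (Matrix.diagonal s).det := by
    simpa [Matrix.det_diagonal, Finset.prod_eq_zero_iff] using hs
  constructor
  · rw [coeffP, pairMatrix_smul, Matrix.mul_inv_rev, ← Matrix.mulVec_mulVec, coeffP]
    congr 1
    have : (fun j => -(K j ^ n * (s * E) j)) = Matrix.diagonal s *ᵥ fun j => -(K j ^ n * E j) := by
      ext j; simp [Matrix.mulVec_diagonal]; ring
    rw [this, Matrix.mulVec_mulVec, Matrix.nonsing_inv_mul _ hdet, Matrix.one_mulVec]
  · rw [coeffQ, pairMatrix_smul, Matrix.mul_inv_rev, ← Matrix.mulVec_mulVec, coeffQ]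
    congr 1
    have : (fun j => -(Λ j ^ n * (s * F) j)) = Matrix.diagonal s *ᵥ fun j => -(Λ j ^ n * F j) := by
      ext j; simp [Matrix.mulVec_diagonal]; ring
    rw [this, Matrix.mulVec_mulVec, Matrix.nonsing_inv_mul _ hdet, Matrix.one_mulVec]

lemma det_pairMatrix_smul_ne_zero_iff (m : ℕ) (K Λ E F s : Fin (n + n) → ℂ) (hs : ∀ j, s j ≠ 0) :
    (pairMatrix m K Λ (s * E) (s * F)).det ≠ 0 ↔ (pairMatrix m K Λ E F).det ≠ 0 := by
  rw [pairMatrix_smul, Matrix.det_mul, Matrix.det_diagonal]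
  have := Finset.prod_ne_zero_iff.2 fun j (_ : j ∈ Finset.univ) => hs j
  simp [this]

/-- Both matrices have the same columns up to order. Moving the replaced column `Λ^n` from position
`n - 1` to the last position `2n - 1` is a cycle made of `n` transpositions, whence the sign. -/
lemma det_pairMatrix_pred (hn : 1 ≤ n) (K Λ E F : Fin (n + n) → ℂ) :
    (pairMatrix (n - 1) K Λ E F).det = (-1) ^ n *
      ((pairMatrix n K Λ E F).updateCol ⟨n - 1, by omega⟩ fun j => Λ j ^ n * F j).det := by
  have : NeZero (n + n) := ⟨by omega⟩
  set i : Fin (n + n) := ⟨n - 1, by omega⟩ with hi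
  set l : Fin (n + n) := ⟨n + n - 1, by omega⟩ with hl
  have hil : i ≤ l := by simp [hi, hl, Fin.le_def]; omega
  have h : pairMatrix (n - 1) K Λ E F = ((pairMatrix n K Λ E F).updateCol i
      fun j => Λ j ^ n * F j).submatrix id (Fin.cycleIcc i l) := by
    ext j q
    rw [Matrix.submatrix_apply]
    rcases lt_or_ge q i with hq | hq
    · rw [Fin.cycleIcc_of_lt hq, Matrix.updateCol_ne hq.ne]
      have h1 : (q : ℕ) < n - 1 := hq
      have h2 : (q : ℕ) < n := by omega
      simp [pairMatrix, h1, h2]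
    · have hql : q ≤ l := by simp [hl, Fin.le_def]; omega
      have h1 : ¬ (q : ℕ) < n - 1 := not_lt.2 hq
      rw [Fin.cycleIcc_of_le_of_le hq hql]
      split_ifs with hh
      · rw [Matrix.updateCol_self]
        have h3 : (q : ℕ) - (n - 1) = n := by
          have : (q : ℕ) = n + n - 1 := congrArg Fin.val hh
          omega
        simp [pairMatrix, h1, h3]
      · have h4 : ((q + 1 : Fin (n + n)) : ℕ) = q + 1 := by
          apply Fin.val_add_one_of_lt'
          have : (q : ℕ) ≠ n + n - 1 := fun h => hh (Fin.ext h)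
          omega
        have h5 : q + 1 ≠ i := by
          intro h6
          have := congrArg Fin.val h6
          rw [h4] at this
          simp only [hi] at this
          omega
        rw [Matrix.updateCol_ne h5]
        have h7 : ¬ (q : ℕ) + 1 < n := by omega
        have h8 : (q : ℕ) + 1 - n = q - (n - 1) := by omega
        simp [pairMatrix, h1, h4, h7, h8]
  rw [h, Matrix.det_permute', Fin.sign_cycleIcc_of_le hil]
  have : (l : ℕ) - i = n := by simp [hi, hl]; omega
  rw [this]
  push_cast
  rfl

/-- Cramer's rule for the last coefficient of the first member. The sign `(-1)^(n+1)` combines the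
minus on the right-hand side of the system with the sign of the column cycle. -/
lemma coeffQ_top (hn : 1 ≤ n) (K Λ E F : Fin (n + n) → ℂ) :
    coeffQ K Λ E F (Fin.castAdd n ⟨n - 1, by omega⟩) =
      (-1) ^ (n + 1) * (pairMatrix (n - 1) K Λ E F).det / (pairMatrix n K Λ E F).det := by
  have h1 : (fun j => -(Λ j ^ n * F j)) = -(fun j => Λ j ^ n * F j) := rfl
  rw [det_pairMatrix_pred hn, coeffQ, h1, Matrix.mulVec_neg, Matrix.inv_def, Matrix.smul_mulVec,
    ← Matrix.cramer_eq_adjugate_mulVec, Pi.neg_apply, Pi.smul_apply, Matrix.cramer_apply,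
    Ring.inverse_eq_inv', ← mul_assoc, ← pow_add, show n + 1 + n = 2 * n + 1 by ring, pow_succ,
    pow_mul]
  simp [Fin.castAdd, div_eq_inv_mul]

end

end INLS

/-! ### Positivity of the Cauchy form and of its small twists -/

namespace INLS

noncomputable section

open Polynomial Matrix

variable {n : ℕ}

-- `1/(conj k_l + k_j)` is the `L²(0, ∞)` inner product of `e^{-k_l r}` and `e^{-k_j r}`, so the
-- form is a squared norm.
open ComplexConjugate in
lemma cauchy_form_eq_integral (k α : Fin n → ℂ) (hk : ∀ j, 0 < (k j).re) :
    ∑ l, conj (α l) * ∑ j, 1 / (conj (k l) + k j) * α j =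
      ((∫ r in Set.Ioi (0 : ℝ), ‖∑ j, α j * Complex.exp (-k j * r)‖ ^ 2 : ℝ) : ℂ) := by
  have hre : ∀ l j, (-(conj (k l) + k j)).re < 0 := fun l j => by
    have := hk l; have := hk j
    simp; linarith
  have hint : ∀ l j, IntegrableOn
      (fun r : ℝ => conj (α l) * α j * Complex.exp (-(conj (k l) + k j) * r)) (Set.Ioi 0) :=
    fun l j => (integrableOn_exp_mul_complex_Ioi (hre l j) 0).const_mul _
  have h1 : ∀ r : ℝ, ((‖∑ j, α j * Complex.exp (-k j * r)‖ ^ 2 : ℝ) : ℂ) =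
      ∑ l, ∑ j, conj (α l) * α j * Complex.exp (-(conj (k l) + k j) * r) := by
    intro r
    push_cast
    rw [← Complex.conj_mul', map_sum, Finset.sum_mul_sum]
    refine Finset.sum_congr rfl fun l _ => Finset.sum_congr rfl fun j _ => ?_
    rw [map_mul, ← Complex.exp_conj, map_mul, map_neg, Complex.conj_ofReal,
      show -(conj (k l) + k j) * (r : ℂ) = -conj (k l) * r + -k j * r by ring, Complex.exp_add]
    ring
  rw [← integral_complex_ofReal]
  simp_rw [h1]
  rw [integral_finsetSum _ fun l _ => integrable_finsetSum _ fun j _ => hint l j]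
  refine Finset.sum_congr rfl fun l _ => ?_
  rw [integral_finsetSum _ fun j _ => hint l j, Finset.mul_sum]
  refine Finset.sum_congr rfl fun j _ => ?_
  have hne : conj (k l) + k j ≠ 0 := fun h => by
    have := hre l j
    rw [h] at this; simp at this
  rw [integral_const_mul, integral_exp_mul_complex_Ioi (hre l j)]
  simp only [Complex.ofReal_zero, mul_zero, Complex.exp_zero]
  rw [neg_div_neg_eq]
  ring

/-- The Hermitian Cauchy matrix `1 / (k̄_l + k_j)`. -/
def cauchyGram (k : Fin n → ℂ) : Matrix (Fin n) (Fin n) ℂ :=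
  Matrix.of fun l j => 1 / (star (k l) + k j)

-- Semidefiniteness comes from the Gram representation, so only the kernel has to be excluded. A
-- kernel vector `α` makes the rational function `∑ α_j / (z + k_j)` vanish at the `n` distinct
-- points `conj k_l`, too many for its numerator.
open ComplexOrder in
lemma cauchyGram_posDef (k : Fin n → ℂ) (hk : ∀ j, 0 < (k j).re) (hinj : Function.Injective k) :
    (cauchyGram k).PosDef := by
  have hherm : (cauchyGram k).IsHermitian := by
    ext l j
    simp [cauchyGram, add_comm]
  have hpsd : (cauchyGram k).PosSemidef := by
    refine Matrix.PosSemidef.of_dotProduct_mulVec_nonneg hherm fun α => ?_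
    have := cauchy_form_eq_integral k α hk
    have h2 : star α ⬝ᵥ (cauchyGram k *ᵥ α) =
        ((∫ r in Set.Ioi (0 : ℝ), ‖∑ j, α j * Complex.exp (-k j * r)‖ ^ 2 : ℝ) : ℂ) := by
      rw [← this]; rfl
    rw [h2]
    exact_mod_cast integral_nonneg fun r => by positivity
  rw [hpsd.posDef_iff_det_ne_zero]
  intro hdet
  obtain ⟨α, hα, h⟩ := Matrix.exists_mulVec_eq_zero_iff.2 hdet
  apply hα
  have hne : ∀ l j, star (k l) + k j ≠ 0 := fun l j h => by
    have h1 := congrArg Complex.re h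
    have := hk l; have := hk j
    simp at h1; linarith
  -- The numerator of `∑ α_j / (X + k_j)` over the common denominator. Its value at `-k_j` isolates
  -- `α_j`.
  set N : ℂ[X] := ∑ j, C (α j) * ∏ m ∈ Finset.univ.erase j, (X + C (k m)) with hN
  have hdeg : N.degree < n := by
    refine (Polynomial.degree_sum_le _ _).trans_lt ?_
    refine (Finset.sup_lt_iff (WithBot.bot_lt_coe n)).2 fun j _ => ?_
    refine (Polynomial.degree_mul_le_of_le degree_C_le le_rfl).trans_lt ?_
    rw [zero_add, Polynomial.degree_prod]
    simp only [degree_X_add_C, Finset.sum_const, Finset.card_erase_of_mem (Finset.mem_univ j),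
      Finset.card_univ, Fintype.card_fin, nsmul_eq_mul, mul_one]
    exact Nat.cast_lt.2 (Nat.sub_lt (Nat.pos_of_ne_zero (by rintro rfl; exact j.elim0)) one_pos)
  have hzero : N = 0 := by
    refine Polynomial.eq_zero_of_degree_lt_of_eval_index_eq_zero (s := Finset.univ)
      (v := fun l : Fin n => star (k l)) (fun a _ b _ hab => hinj (star_injective hab))
      (by simpa using hdeg)
      fun l _ => ?_
    have h1 : ∑ j, 1 / (star (k l) + k j) * α j = 0 := congrFun h l
    have h2 : N.eval (star (k l)) =
        (∏ m, (star (k l) + k m)) * ∑ j, 1 / (star (k l) + k j) * α j := by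
      rw [hN, eval_finsetSum, Finset.mul_sum]
      refine Finset.sum_congr rfl fun j _ => ?_
      rw [← Finset.mul_prod_erase _ _ (Finset.mem_univ j), eval_mul, eval_prod]
      simp only [eval_C, eval_add, eval_X]
      have hlj := hne l j
      generalize star (k l) + k j = b at hlj ⊢
      field_simp
    rw [h2, h1, mul_zero]
  ext j
  have h3 : N.eval (-k j) = α j * ∏ m ∈ Finset.univ.erase j, (-k j + k m) := by
    rw [hN, eval_finsetSum, Finset.sum_eq_single j]
    · simp [eval_prod]
    · intro i _ hij
      rw [eval_mul, eval_prod, Finset.prod_eq_zero (i := j)]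
      · simp
      · simp [hij.symm]
      · simp
    · simp
  rw [hzero, eval_zero] at h3
  have h4 : ∏ m ∈ Finset.univ.erase j, (-k j + k m) ≠ 0 := by
    refine Finset.prod_ne_zero_iff.2 fun m hm => ?_
    intro h5
    exact (Finset.ne_of_mem_erase hm) (hinj (by linear_combination h5))
  simpa [h4] using h3.symm

open ComplexOrder MatrixOrder in
lemma exists_isUnit_factor {C : Matrix (Fin n) (Fin n) ℂ} (h : C.PosDef) :
    ∃ V : Matrix (Fin n) (Fin n) ℂ, IsUnit V ∧ C = Vᴴ * V := by
  obtain ⟨V, hV⟩ := CStarAlgebra.nonneg_iff_eq_star_mul_self.1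
    (Matrix.nonneg_iff_posSemidef.2 h.posSemidef)
  refine ⟨V, ?_, hV⟩
  have h1 := h.isUnit
  rw [hV, Matrix.isUnit_iff_isUnit_det, Matrix.det_mul] at h1
  exact (Matrix.isUnit_iff_isUnit_det _).2 (isUnit_of_mul_isUnit_right h1)

open scoped Matrix.Norms.Frobenius

lemma trace_conjTranspose_mul_self_eq (A : Matrix (Fin n) (Fin n) ℂ) :
    (Aᴴ * A).trace = ((‖A‖ ^ 2 : ℝ) : ℂ) := by
  rw [Matrix.frobenius_norm_def, ← Real.sqrt_eq_rpow, Real.sq_sqrt (by positivity), Matrix.trace,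
    Finset.sum_comm]
  push_cast
  refine Finset.sum_congr rfl fun j _ => ?_
  rw [Matrix.diag_apply, Matrix.mul_apply]
  refine Finset.sum_congr rfl fun i _ => ?_
  rw [Matrix.conjTranspose_apply, Complex.star_def, Complex.conj_mul']
  norm_cast

/-- A matrix whose Hermitian part has rank one is controlled by its traces. -/
lemma two_mul_norm_sq_of_rank_one (T : Matrix (Fin n) (Fin n) ℂ) (y : Fin n → ℂ)
    (hT : T + Tᴴ = Matrix.vecMulVec y (star y)) :
    2 * ‖T‖ ^ 2 = (2 * T.trace.re) ^ 2 - 2 * (T * T).trace.re := by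
  have h1 : (T + Tᴴ).trace = ((2 * T.trace.re : ℝ) : ℂ) := by
    rw [Matrix.trace_add, Matrix.trace_conjTranspose, Complex.star_def, Complex.add_conj]
  have h2 : ((T + Tᴴ) * (T + Tᴴ)).trace = (T + Tᴴ).trace ^ 2 := by
    rw [hT, Matrix.vecMulVec_mul_vecMulVec, Matrix.trace_vecMulVec, Matrix.trace_vecMulVec, sq,
      dotProduct_smul, dotProduct_comm]
    rfl
  have h3 : ((T + Tᴴ) * (T + Tᴴ)).trace =
      (T * T).trace + star (T * T).trace + 2 * ((‖T‖ ^ 2 : ℝ) : ℂ) := by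
    rw [← trace_conjTranspose_mul_self_eq, ← Matrix.trace_conjTranspose, Matrix.conjTranspose_mul,
      add_mul, mul_add, mul_add, Matrix.trace_add, Matrix.trace_add, Matrix.trace_add,
      Matrix.trace_mul_comm T Tᴴ]
    ring
  rw [h1, h3, Complex.star_def, Complex.add_conj] at h2
  have h4 : (2 * (T * T).trace.re + 2 * ‖T‖ ^ 2 : ℝ) = (2 * T.trace.re) ^ 2 := by
    exact_mod_cast h2
  linarith

/-- The bound does not involve the condition number of `V`, which blows up when the `k_j` merge. The
Lyapunov identity for the Cauchy matrix makes the Hermitian part of `V diag(k) V⁻¹` of rank one, and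
then the Frobenius norm depends only on the traces `∑ k_j` and `∑ k_j²`. -/
lemma norm_conjugate_diagonal_le {k : Fin n → ℂ} {ε : ℝ} (hk : ∀ j, 0 < (k j).re)
    (hε : ∀ j, ‖k j‖ ≤ ε) {V : Matrix (Fin n) (Fin n) ℂ} (hV : IsUnit V)
    (hC : cauchyGram k = Vᴴ * V) (hε0 : 0 ≤ ε) :
    ‖V * Matrix.diagonal k * V⁻¹‖ ≤ (2 * n + 1) * ε := by
  have hdet : IsUnit V.det := (Matrix.isUnit_iff_isUnit_det _).1 hV
  have hdet' : IsUnit Vᴴ.det := by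
    rw [Matrix.det_conjTranspose]; exact hdet.star
  set T := V * Matrix.diagonal k * V⁻¹ with hT
  have hne : ∀ l j, star (k l) + k j ≠ 0 := fun l j h => by
    have h1 := congrArg Complex.re h
    have := hk l; have := hk j
    simp at h1; linarith
  -- Entrywise this is `(k_j + conj k_l) / (conj k_l + k_j) = 1`.
  have hlyap : Vᴴ * V * Matrix.diagonal k + Matrix.diagonal (star k) * (Vᴴ * V) =
      Matrix.vecMulVec 1 1 := by
    rw [← hC]
    ext l j
    have := hne l j
    simp only [Matrix.add_apply, Matrix.mul_diagonal, Matrix.diagonal_mul, cauchyGram,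
      Matrix.of_apply, Matrix.vecMulVec_apply, Pi.star_apply, Pi.one_apply]
    field_simp
    ring
  have hrank : T + Tᴴ = Matrix.vecMulVec ((V⁻¹)ᴴ *ᵥ 1) (star ((V⁻¹)ᴴ *ᵥ 1)) := by
    have h1 : Matrix.vecMulVec ((V⁻¹)ᴴ *ᵥ 1) (star ((V⁻¹)ᴴ *ᵥ (1 : Fin n → ℂ))) =
        (V⁻¹)ᴴ * Matrix.vecMulVec 1 1 * V⁻¹ := by
      rw [Matrix.star_mulVec, Matrix.conjTranspose_conjTranspose, Matrix.mul_vecMulVec,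
        Matrix.vecMulVec_mul, star_one]
    rw [h1, ← hlyap, hT, Matrix.mul_add, Matrix.add_mul, Matrix.conjTranspose_mul,
      Matrix.conjTranspose_mul, Matrix.diagonal_conjTranspose, Matrix.conjTranspose_nonsing_inv]
    congr 1
    · rw [Matrix.mul_assoc Vᴴ V, Matrix.nonsing_inv_mul_cancel_left _ _ hdet']
    · simp only [Matrix.mul_assoc]
      rw [Matrix.mul_nonsing_inv _ hdet, Matrix.mul_one]
  have htr : T.trace = ∑ j, k j := by
    rw [hT, Matrix.trace_mul_comm, Matrix.nonsing_inv_mul_cancel_left _ _ hdet,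
      Matrix.trace_diagonal]
  have htr2 : (T * T).trace = ∑ j, k j * k j := by
    have : T * T = V * (Matrix.diagonal k * Matrix.diagonal k) * V⁻¹ := by
      rw [hT]
      simp only [Matrix.mul_assoc]
      rw [Matrix.nonsing_inv_mul_cancel_left _ _ hdet]
    rw [this, Matrix.trace_mul_comm, Matrix.nonsing_inv_mul_cancel_left _ _ hdet,
      Matrix.diagonal_mul_diagonal, Matrix.trace_diagonal]
  have key := two_mul_norm_sq_of_rank_one T _ hrank
  have b1 : |T.trace.re| ≤ n * ε := by
    refine (Complex.abs_re_le_norm _).trans ?_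
    rw [htr]
    refine (norm_sum_le _ _).trans ((Finset.sum_le_sum fun j _ => hε j).trans ?_)
    simp
  have b2 : |(T * T).trace.re| ≤ n * ε ^ 2 := by
    refine (Complex.abs_re_le_norm _).trans ?_
    rw [htr2]
    refine (norm_sum_le _ _).trans ((Finset.sum_le_sum (g := fun _ => ε ^ 2) fun j _ => ?_).trans ?_)
    · rw [norm_mul, sq]; exact mul_le_mul (hε j) (hε j) (norm_nonneg _) hε0
    · simp
  have b3 : T.trace.re ^ 2 ≤ (n * ε) ^ 2 := sq_le_sq' (by linarith [abs_le.1 b1]) (abs_le.1 b1).2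
  have b4 := (abs_le.1 b2).1
  refine abs_le_of_sq_le_sq' ?_ (by positivity) |>.2
  have hn0 : (0 : ℝ) ≤ n := Nat.cast_nonneg n
  -- The traces give `2‖T‖² ≤ 4n²ε² + 2nε²`, which is below `2(2n+1)²ε²`.
  nlinarith [mul_nonneg hn0 (sq_nonneg ε), sq_nonneg ε,
    mul_nonneg (mul_nonneg hn0 hn0) (sq_nonneg ε)]

lemma norm_dotProduct_mulVec_le (X : Matrix (Fin n) (Fin n) ℂ) (u : Fin n → ℂ) :
    ‖star u ⬝ᵥ (X *ᵥ u)‖ ≤ ‖X‖ * ∑ i, ‖u i‖ ^ 2 := by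
  set c : Matrix (Fin n) Unit ℂ := Matrix.of fun i _ => u i with hc
  have h1 : star u ⬝ᵥ (X *ᵥ u) = (cᴴ * (X * c)) () () := by
    simp [Matrix.mul_apply, hc, dotProduct, Matrix.mulVec]
  have h2 : ‖(cᴴ * (X * c)) () ()‖ = ‖cᴴ * (X * c)‖ := by
    rw [Matrix.frobenius_norm_def, ← Real.sqrt_eq_rpow]
    simp
  have h3 : ‖c‖ ^ 2 = ∑ i, ‖u i‖ ^ 2 := by
    rw [Matrix.frobenius_norm_def, ← Real.sqrt_eq_rpow, Real.sq_sqrt (by positivity)]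
    simp [hc]
  rw [h1, h2, ← h3]
  refine (Matrix.frobenius_norm_mul _ _).trans ?_
  rw [Matrix.frobenius_norm_conjTranspose]
  refine (mul_le_mul_of_nonneg_left (Matrix.frobenius_norm_mul _ _) (norm_nonneg _)).trans_eq ?_
  ring

/-- For small `k` the Cauchy form twisted by `exp (2 i s k)` keeps a positive real part. -/
lemma exists_twisted_cauchy_re_pos (n : ℕ) (δ : ℝ) (hδ : 0 < δ) : ∃ ε : ℝ, 0 < ε ∧
    ∀ k : Fin n → ℂ, Function.Injective k → (∀ j, 0 < (k j).re) → (∀ j, ‖k j‖ < ε) →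
      ∀ s : ℝ, |s| ≤ δ → ∀ α : Fin n → ℂ, α ≠ 0 →
        0 < (star α ⬝ᵥ (cauchyGram k *ᵥ fun j => Complex.exp (2 * Complex.I * s * k j) * α j)).re := by
  have hcont : ContinuousAt (NormedSpace.exp : Matrix (Fin n) (Fin n) ℂ → _) 0 :=
    NormedSpace.exp_continuous.continuousAt
  obtain ⟨ρ, hρ, hexp⟩ := Metric.continuousAt_iff.1 hcont 1 one_pos
  -- Chosen so that `‖2is T‖ ≤ 2δ(2n+1)ε = ρ/2`, where within radius `ρ` of zero the matrix
  -- exponential differs from the identity by less than 1 in Frobenius norm.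
  refine ⟨ρ / (2 * δ * (2 * n + 1)) / 2, by positivity, fun k hinj hre hk s hs α hα => ?_⟩
  set ε := ρ / (2 * δ * (2 * n + 1)) / 2 with hε
  have hε0 : 0 < ε := by positivity
  obtain ⟨V, hV, hC⟩ := exists_isUnit_factor (cauchyGram_posDef k hre hinj)
  have hdet : IsUnit V.det := (Matrix.isUnit_iff_isUnit_det _).1 hV
  have hT := norm_conjugate_diagonal_le hre (fun j => (hk j).le) hV hC hε0.le
  set T := V * Matrix.diagonal k * V⁻¹ with hTdef
  set u := V *ᵥ α with hu
  have hu0 : u ≠ 0 := fun h => hα (Matrix.eq_zero_of_mulVec_eq_zero hdet.ne_zero h)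
  set A := (2 * Complex.I * s) • T with hA
  have hA' : A = V * Matrix.diagonal (fun j => 2 * Complex.I * s * k j) * V⁻¹ := by
    have : Matrix.diagonal (fun j => 2 * Complex.I * s * k j) =
      (2 * Complex.I * s) • Matrix.diagonal k := by
      rw [← Matrix.diagonal_smul]; rfl
    rw [this, Matrix.mul_smul, Matrix.smul_mul]
  have hexpA : NormedSpace.exp A =
      V * Matrix.diagonal (fun j => Complex.exp (2 * Complex.I * s * k j)) * V⁻¹ := by
    rw [hA', Matrix.exp_conj _ _ hV, Matrix.exp_diagonal]
    congr 3
    ext j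
    rw [Pi.coe_exp, Complex.exp_eq_exp_ℂ]
  have hAn : ‖A‖ < ρ := by
    rw [hA, norm_smul]
    have : ‖(2 * Complex.I * s : ℂ)‖ ≤ 2 * δ := by
      simp only [norm_mul, Complex.norm_I, Complex.norm_real, Real.norm_eq_abs]
      norm_num; exact hs
    calc _ ≤ 2 * δ * ((2 * n + 1) * ε) := by gcongr
      _ = ρ / 2 := by rw [hε]; field_simp
      _ < ρ := by linarith
  have hE := hexp (x := A) (by simpa using hAn)
  rw [NormedSpace.exp_zero, dist_eq_norm] at hE
  -- In the coordinates `u = V α` the Cauchy form is the standard inner product and the twist is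
  -- `exp(2is T)`, a small perturbation of the identity.
  have hform : star α ⬝ᵥ (cauchyGram k *ᵥ fun j => Complex.exp (2 * Complex.I * s * k j) * α j) =
      star u ⬝ᵥ (NormedSpace.exp A *ᵥ u) := by
    have h1 : (fun j => Complex.exp (2 * Complex.I * s * k j) * α j) =
        Matrix.diagonal (fun j => Complex.exp (2 * Complex.I * s * k j)) *ᵥ α := by
      ext j; rw [Matrix.mulVec_diagonal]
    rw [h1, hC, hexpA, hu, Matrix.star_mulVec, Matrix.mulVec_mulVec, Matrix.mulVec_mulVec,
      Matrix.nonsing_inv_mul_cancel_right _ _ hdet, ← Matrix.dotProduct_mulVec,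
      Matrix.mulVec_mulVec, Matrix.mul_assoc]
  have hsplit : NormedSpace.exp A *ᵥ u = u + (NormedSpace.exp A - 1) *ᵥ u := by
    rw [Matrix.sub_mulVec, Matrix.one_mulVec]; abel
  have hself : (star u ⬝ᵥ u).re = ∑ i, ‖u i‖ ^ 2 := by
    rw [dotProduct, Complex.re_sum]
    refine Finset.sum_congr rfl fun i _ => ?_
    rw [Pi.star_apply, Complex.star_def, Complex.conj_mul']
    norm_cast
  have hpos : 0 < ∑ i, ‖u i‖ ^ 2 := by
    obtain ⟨i, hi⟩ := Function.ne_iff.1 hu0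
    exact Finset.sum_pos' (fun _ _ => by positivity) ⟨i, Finset.mem_univ i, by
      have := norm_pos_iff.2 hi; positivity⟩
  have hb := (Complex.abs_re_le_norm _).trans (norm_dotProduct_mulVec_le (NormedSpace.exp A - 1) u)
  have hb2 := (abs_le.1 hb).1
  rw [hform, hsplit, dotProduct_add, Complex.add_re, hself]
  nlinarith

end

end INLS

/-! ### Reflection symmetry of the nodes: duality and residues -/

namespace INLS

noncomputable section

open Polynomial Matrix

variable {n : ℕ}

/-- The involution `j ↔ n + j` of the indices. -/
def mirror (j : Fin (n + n)) : Fin (n + n) :=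
  Fin.addCases (fun i => Fin.natAdd n i) (fun i => Fin.castAdd n i) j

lemma mirror_castAdd (i : Fin n) : mirror (Fin.castAdd n i) = Fin.natAdd n i := by
  simp [mirror, -Fin.natAdd_eq_addNat]

lemma mirror_natAdd (i : Fin n) : mirror (Fin.natAdd n i) = Fin.castAdd n i := by
  simp only [mirror, Fin.addCases_right]

lemma mirror_mirror (j : Fin (n + n)) : mirror (mirror j) = j := by
  refine Fin.addCases (fun i => ?_) (fun i => ?_) j
  · rw [mirror_castAdd, mirror_natAdd]
  · rw [mirror_natAdd, mirror_castAdd]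

/-- Nodes and weights with the reflection symmetry used for the soliton solutions. -/
structure MirrorData (K Λ c : Fin (n + n) → ℂ) : Prop where
  K_inj : Function.Injective K
  Λ_inj : Function.Injective Λ
  star_K : ∀ j, star (K j) = -K (mirror j)
  star_Λ : ∀ j, star (Λ j) = -Λ (mirror j)
  re_K : ∀ i : Fin n, 0 < (K (Fin.castAdd n i)).re
  re_Λ : ∀ i : Fin n, 0 < (Λ (Fin.castAdd n i)).re
  weight : ∀ j, c j * star (c (mirror j)) =
    -∏ l ∈ Finset.univ.erase j, (Λ j - Λ l) / (K j - K l)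

lemma prod_erase_sub_ne_zero {ι : Type*} [Fintype ι] [DecidableEq ι] {v : ι → ℂ}
    (hv : Function.Injective v) (j : ι) : ∏ l ∈ Finset.univ.erase j, (v j - v l) ≠ 0 :=
  Finset.prod_ne_zero_iff.2 fun _ hl =>
    sub_ne_zero.2 fun h => (Finset.ne_of_mem_erase hl) (hv h).symm

/-- The polynomial `z ↦ conj (A (-conj z))`. -/
def reflect (A : ℂ[X]) : ℂ[X] := (A.map (starRingEnd ℂ)).comp (C (-1) * X)

lemma eval_reflect (A : ℂ[X]) (z : ℂ) : (reflect A).eval z = star (A.eval (-star z)) := by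
  rw [reflect, eval_comp, eval_mul, eval_C, eval_X, Complex.star_def, ← Polynomial.eval_map_apply]
  simp

lemma coeff_reflect (A : ℂ[X]) (m : ℕ) : (reflect A).coeff m = (-1) ^ m * star (A.coeff m) := by
  rw [reflect, Polynomial.comp_C_mul_X_coeff]
  simp [mul_comm]

lemma natDegree_reflect_le (A : ℂ[X]) : (reflect A).natDegree ≤ A.natDegree := by
  refine Polynomial.natDegree_comp_le.trans ?_
  rw [natDegree_C_mul_X _ (by norm_num), mul_one]
  exact natDegree_map_le

/-- Duality between the two kinds of solutions. -/
lemma star_coeff_eq (hn : 1 ≤ n) {K Λ c : Fin (n + n) → ℂ} (h : MirrorData K Λ c)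
    {e e' : Fin (n + n) → ℂ} (he : ∀ j, e' j * star (e (mirror j)) = 1)
    {P Q P' Q' : ℂ[X]} (hP : P.degree < n) (hQ : Q.degree < n) (hP' : P'.degree < n)
    (hQ' : Q'.degree < n)
    (h1 : ∀ j, P.eval (K j) * (c j * e j) + (X ^ n + Q).eval (Λ j) = 0)
    (h2 : ∀ j, (X ^ n + P').eval (K j) * (c j * e' j) + Q'.eval (Λ j) = 0) :
    star (P.coeff (n - 1)) = Q'.coeff (n - 1) := by
  have hdeg : ∀ A : ℂ[X], A.degree < n → A.natDegree ≤ n - 1 := fun A hA =>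
    natDegree_le_of_degree_le ((Polynomial.degree_le_iff_coeff_zero _ _).2 fun m hm => by
      have : n - 1 < m := by exact_mod_cast hm
      exact coeff_eq_zero_of_degree_lt (hA.trans_le (by exact_mod_cast (by omega : n ≤ m))))
  have hmon : ∀ A : ℂ[X], A.degree < n →
      (X ^ n + A).natDegree ≤ n ∧ (X ^ n + A).coeff n = 1 := fun A hA => by
    constructor
    · refine (natDegree_add_le _ _).trans (max_le (natDegree_X_pow_le n) ?_)
      exact (hdeg A hA).trans (Nat.sub_le n 1)
    · simp [coeff_eq_zero_of_degree_lt hA]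
  have hcard : (Finset.univ : Finset (Fin (n + n))).card - 1 = n + (n - 1) := by simp; omega
  have hlt : ∀ A : ℂ[X], A.natDegree ≤ n + (n - 1) →
      A.degree < (Finset.univ : Finset (Fin (n + n))).card := fun A hA => by
    refine (degree_le_of_natDegree_le hA).trans_lt ?_
    rw [Finset.card_univ, Fintype.card_fin]
    exact_mod_cast (by omega : n + (n - 1) < n + n)
  -- Both products have degree at most `2n - 1`, so their coefficients there are divided differences
  -- over all `2n` nodes: sums of values divided by `∏ (K_j - K_l)`, respectively `∏ (Λ_j - Λ_l)`.
  have hR : (((X ^ n + P') * reflect P).coeff (n + (n - 1))) =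
      (-1) ^ (n - 1) * star (P.coeff (n - 1)) := by
    rw [coeff_mul_add_eq_of_natDegree_le (hmon P' hP').1 ((natDegree_reflect_le P).trans (hdeg P hP)),
      (hmon P' hP').2, coeff_reflect, one_mul]
  have hS : ((reflect (X ^ n + Q) * Q').coeff (n + (n - 1))) =
      (-1) ^ n * Q'.coeff (n - 1) := by
    rw [coeff_mul_add_eq_of_natDegree_le ((natDegree_reflect_le _).trans (hmon Q hQ).1) (hdeg Q' hQ'),
      coeff_reflect, (hmon Q hQ).2]
    simp
  rw [← hcard, Lagrange.coeff_eq_sum (v := K) h.K_inj.injOn (hlt _ (natDegree_mul_le.trans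
    (add_le_add (hmon P' hP').1 ((natDegree_reflect_le P).trans (hdeg P hP)))))] at hR
  rw [← hcard, Lagrange.coeff_eq_sum (v := Λ) h.Λ_inj.injOn (hlt _ (natDegree_mul_le.trans
    (add_le_add ((natDegree_reflect_le _).trans (hmon Q hQ).1) (hdeg Q' hQ'))))] at hS
  -- The two divided differences agree term by term up to sign: multiply the equation at `j` by the
  -- conjugated equation at the mirror index. The exponentials cancel by `he`, and the weights turn
  -- one denominator into the other.
  have hterm : ∀ j, ((X ^ n + P') * reflect P).eval (K j) /
        ∏ l ∈ Finset.univ.erase j, (K j - K l) =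
      -((reflect (X ^ n + Q) * Q').eval (Λ j) / ∏ l ∈ Finset.univ.erase j, (Λ j - Λ l)) := by
    intro j
    have hk := prod_erase_sub_ne_zero h.K_inj j
    have hl := prod_erase_sub_ne_zero h.Λ_inj j
    have hw := h.weight j
    rw [Finset.prod_div_distrib] at hw
    have a1 := congrArg star (h1 (mirror j))
    rw [star_add, star_mul', star_mul', star_zero] at a1
    have a2 := h2 j
    have a3 : (reflect P).eval (K j) = star (P.eval (K (mirror j))) := by
      rw [eval_reflect, h.star_K, neg_neg]
    have a4 : (reflect (X ^ n + Q)).eval (Λ j) = star ((X ^ n + Q).eval (Λ (mirror j))) := by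
      rw [eval_reflect, h.star_Λ, neg_neg]
    rw [eval_mul, eval_mul, a3, a4]
    have a5 := he j
    generalize star (P.eval (K (mirror j))) = p at *
    generalize star ((X ^ n + Q).eval (Λ (mirror j))) = q at *
    generalize (X ^ n + P').eval (K j) = p' at *
    generalize Q'.eval (Λ j) = q' at *
    generalize ∏ l ∈ Finset.univ.erase j, (K j - K l) = dk at *
    generalize ∏ l ∈ Finset.univ.erase j, (Λ j - Λ l) = dl at *
    have a6 : p' * p * (c j * star (c (mirror j))) = q * q' := by
      linear_combination (-(p' * p * (c j * star (c (mirror j))))) * a5 +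
        (p' * (c j * e' j)) * a1 - q * a2
    rw [hw] at a6
    field_simp at a6 ⊢
    linear_combination (-1) * a6
  have hsum := hR
  rw [Finset.sum_congr rfl fun j _ => hterm j, Finset.sum_neg_distrib, hS] at hsum
  obtain ⟨m, rfl⟩ : ∃ m, n = m + 1 := ⟨n - 1, by omega⟩
  rw [pow_succ] at hsum
  simp only [add_tsub_cancel_right] at hsum ⊢
  have h3 : ((-1 : ℂ)) ^ m ≠ 0 := pow_ne_zero _ (by norm_num)
  apply mul_left_cancel₀ h3
  linear_combination -hsum

lemma prod_erase_castAdd (i : Fin n) (f : Fin (n + n) → ℂ) :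
    ∏ l ∈ Finset.univ.erase (Fin.castAdd n i), f l =
      (∏ l ∈ Finset.univ.erase i, f (Fin.castAdd n l)) * ∏ l, f (Fin.natAdd n l) := by
  have h1 : ∏ l ∈ Finset.univ.erase (Fin.castAdd n i), f l =
      ∏ l, if l = Fin.castAdd n i then 1 else f l := by
    rw [← Finset.prod_erase (a := Fin.castAdd n i) Finset.univ (by simp)]
    exact Finset.prod_congr rfl fun l hl => by rw [if_neg (Finset.ne_of_mem_erase hl)]
  have h2 : ∏ l ∈ Finset.univ.erase i, f (Fin.castAdd n l) =
      ∏ l, if l = i then 1 else f (Fin.castAdd n l) := by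
    rw [← Finset.prod_erase (a := i) Finset.univ (by simp)]
    exact Finset.prod_congr rfl fun l hl => by rw [if_neg (Finset.ne_of_mem_erase hl)]
  rw [h1, h2, Fin.prod_univ_add]
  congr 1
  · exact Finset.prod_congr rfl fun l _ => by simp
  · refine Finset.prod_congr rfl fun l _ => ?_
    rw [if_neg]
    intro h
    have := congrArg Fin.val h
    simp at this
    omega

lemma prod_erase_natAdd (i : Fin n) (f : Fin (n + n) → ℂ) :
    ∏ l ∈ Finset.univ.erase (Fin.natAdd n i), f l =
      (∏ l, f (Fin.castAdd n l)) * ∏ l ∈ Finset.univ.erase i, f (Fin.natAdd n l) := by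
  have h1 : ∏ l ∈ Finset.univ.erase (Fin.natAdd n i), f l =
      ∏ l, if l = Fin.natAdd n i then 1 else f l := by
    rw [← Finset.prod_erase (a := Fin.natAdd n i) Finset.univ (by simp)]
    exact Finset.prod_congr rfl fun l hl => by rw [if_neg (Finset.ne_of_mem_erase hl)]
  have h2 : ∏ l ∈ Finset.univ.erase i, f (Fin.natAdd n l) =
      ∏ l, if l = i then 1 else f (Fin.natAdd n l) := by
    rw [← Finset.prod_erase (a := i) Finset.univ (by simp)]
    exact Finset.prod_congr rfl fun l hl => by rw [if_neg (Finset.ne_of_mem_erase hl)]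
  rw [h1, h2, Fin.prod_univ_add]
  congr 1
  · refine Finset.prod_congr rfl fun l _ => ?_
    rw [if_neg]
    intro h
    have := congrArg Fin.val h
    simp at this
    omega
  · exact Finset.prod_congr rfl fun l _ => by simp

/-- Interpolate `A` at the left nodes `κ_l` and evaluate at the right node, which is `-conj κ_i`.
After conjugation the denominators become `conj κ_l + κ_i`, so summing these residues over `i`
produces the Cauchy form. -/
lemma residue_eq {K : Fin (n + n) → ℂ} (hinj : Function.Injective K)
    (hstar : ∀ j, star (K j) = -K (mirror j)) {A : ℂ[X]} (hA : A.degree < n) (i : Fin n) :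
    A.eval (K (Fin.castAdd n i)) * star (A.eval (K (Fin.natAdd n i))) /
        ∏ l ∈ Finset.univ.erase (Fin.castAdd n i), (K (Fin.castAdd n i) - K l) =
      (-1) ^ (n + 1) * ∑ l, star (A.eval (K (Fin.castAdd n l)) /
          ∏ m ∈ Finset.univ.erase l, (K (Fin.castAdd n l) - K (Fin.castAdd n m))) *
        (cauchyGram (fun l => K (Fin.castAdd n l)) l i *
          (A.eval (K (Fin.castAdd n i)) /
            ∏ m ∈ Finset.univ.erase i, (K (Fin.castAdd n i) - K (Fin.castAdd n m)))) := by
  set κ : Fin n → ℂ := fun l => K (Fin.castAdd n l) with hκ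
  have hκinj : Function.Injective κ := fun a b hab => Fin.castAdd_injective n n (hinj hab)
  have hne : ∀ l m, K (Fin.castAdd n l) - K (Fin.natAdd n m) ≠ 0 := fun l m =>
    sub_ne_zero.2 fun h => by
      have := congrArg Fin.val (hinj h)
      simp at this
      omega
  have hst : ∀ l, star (K (Fin.natAdd n i) - κ l) =
      -(K (Fin.castAdd n i) - K (Fin.natAdd n l)) := fun l => by
    rw [star_sub, hstar, hκ]
    simp only
    rw [hstar, mirror_natAdd, mirror_castAdd]; ring
  have h1 : A.eval (K (Fin.natAdd n i)) = (∏ m, (K (Fin.natAdd n i) - κ m)) *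
      ∑ l, (A.eval (κ l) / ∏ m ∈ Finset.univ.erase l, (κ l - κ m)) /
        (K (Fin.natAdd n i) - κ l) := by
    conv_lhs => rw [Lagrange.eq_interpolate (s := Finset.univ) (v := κ) (f := A) hκinj.injOn
      (by simpa using hA)]
    rw [Lagrange.eval_interpolate_not_at_node _ fun l _ h => hne l i (sub_eq_zero.2 h.symm),
      Lagrange.eval_nodal]
    congr 1
    refine Finset.sum_congr rfl fun l _ => ?_
    rw [Lagrange.nodalWeight, Finset.prod_inv_distrib]
    ring
  have h2 : star (A.eval (K (Fin.natAdd n i))) =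
      ((-1) ^ n * ∏ m, (K (Fin.castAdd n i) - K (Fin.natAdd n m))) *
        ∑ l, star (A.eval (κ l) / ∏ m ∈ Finset.univ.erase l, (κ l - κ m)) *
          -(1 / (K (Fin.castAdd n i) - K (Fin.natAdd n l))) := by
    rw [h1, star_mul', star_sum, star_prod, Finset.prod_congr rfl fun l _ => hst l,
      Finset.prod_neg, Finset.card_univ, Fintype.card_fin]
    congr 1
    refine Finset.sum_congr rfl fun l _ => ?_
    rw [star_div₀, hst, div_eq_mul_one_div, ← div_neg]
  have hC : ∀ l, cauchyGram κ l i = 1 / (K (Fin.castAdd n i) - K (Fin.natAdd n l)) := by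
    intro l
    rw [cauchyGram, Matrix.of_apply, hκ]
    simp only
    rw [hstar, mirror_castAdd]
    congr 1; ring
  have hp : ∏ m, (K (Fin.castAdd n i) - K (Fin.natAdd n m)) ≠ 0 :=
    Finset.prod_ne_zero_iff.2 fun m _ => hne i m
  rw [prod_erase_castAdd, h2]
  have h3 : ∑ l, star (A.eval (κ l) / ∏ m ∈ Finset.univ.erase l, (κ l - κ m)) *
      (cauchyGram κ l i * (A.eval (κ i) / ∏ m ∈ Finset.univ.erase i, (κ i - κ m))) =
      -((∑ l, star (A.eval (κ l) / ∏ m ∈ Finset.univ.erase l, (κ l - κ m)) *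
          -(1 / (K (Fin.castAdd n i) - K (Fin.natAdd n l)))) *
        (A.eval (κ i) / ∏ m ∈ Finset.univ.erase i, (κ i - κ m))) := by
    rw [Finset.sum_mul, ← Finset.sum_neg_distrib]
    refine Finset.sum_congr rfl fun l _ => ?_
    rw [hC]; ring
  rw [h3]
  generalize ∑ l, star (A.eval (κ l) / ∏ m ∈ Finset.univ.erase l, (κ l - κ m)) *
          -(1 / (K (Fin.castAdd n i) - K (Fin.natAdd n l))) = S
  have hq := prod_erase_sub_ne_zero hκinj i
  generalize ∏ m, (K (Fin.castAdd n i) - K (Fin.natAdd n m)) = r at *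
  rw [pow_succ]
  change A.eval (κ i) * _ / ((∏ m ∈ Finset.univ.erase i, (κ i - κ m)) * r) = _
  generalize ∏ m ∈ Finset.univ.erase i, (κ i - κ m) = q at *
  field_simp

end

end INLS

/-! ### Nonvanishing of the determinant, and the soliton parameters -/

namespace INLS

noncomputable section

open Polynomial Matrix

variable {n : ℕ}

lemma dotProduct_mulVec_mul (M : Matrix (Fin n) (Fin n) ℂ) (α g : Fin n → ℂ) :
    star α ⬝ᵥ (M *ᵥ fun j => g j * α j) = ∑ j, (∑ l, star (α l) * (M l j * α j)) * g j := by
  simp only [dotProduct, Matrix.mulVec, Finset.mul_sum, Finset.sum_mul, Pi.star_apply]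
  rw [Finset.sum_comm]
  exact Finset.sum_congr rfl fun j _ => Finset.sum_congr rfl fun l _ => by ring

lemma eq_zero_of_eval_castAdd {K : Fin (n + n) → ℂ} (hinj : Function.Injective K) {A : ℂ[X]}
    (hA : A.degree < n) (h : ∀ i : Fin n, A.eval (K (Fin.castAdd n i)) = 0) : A = 0 :=
  Polynomial.eq_zero_of_degree_lt_of_eval_index_eq_zero (s := Finset.univ)
    (v := fun i : Fin n => K (Fin.castAdd n i))
    (fun _ _ _ _ hab => Fin.castAdd_injective n n (hinj hab)) (by simpa using hA) fun i _ => h i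

open ComplexOrder in
/-- Only the zero pair solves the homogeneous system when the twisted form is positive. -/
lemma det_pairMatrix_ne_zero_of_twisted {K Λ c : Fin (n + n) → ℂ} (h : MirrorData K Λ c)
    {g : Fin n → ℂ}
    (hg : ∀ α : Fin n → ℂ, α ≠ 0 →
      0 < (star α ⬝ᵥ (cauchyGram (fun i => K (Fin.castAdd n i)) *ᵥ fun j => g j * α j)).re)
    {e : Fin (n + n) → ℂ}
    (he : ∀ i : Fin n, e (Fin.castAdd n i) * star (e (Fin.natAdd n i)) = g i) :
    (pairMatrix n K Λ (fun j => c j * e j) 1).det ≠ 0 := by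
  rw [det_pairMatrix_ne_zero_iff]
  intro A B hA hB hAB
  simp only [Pi.one_apply, mul_one] at hAB
  set κ : Fin n → ℂ := fun i => K (Fin.castAdd n i) with hκ
  set μ : Fin n → ℂ := fun i => Λ (Fin.castAdd n i) with hμ
  have hκinj : Function.Injective κ := fun a b hab => Fin.castAdd_injective n n (h.K_inj hab)
  have hμinj : Function.Injective μ := fun a b hab => Fin.castAdd_injective n n (h.Λ_inj hab)
  set α : Fin n → ℂ := fun i => A.eval (κ i) / ∏ m ∈ Finset.univ.erase i, (κ i - κ m) with hα
  set β : Fin n → ℂ := fun i => B.eval (μ i) / ∏ m ∈ Finset.univ.erase i, (μ i - μ m) with hβ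
  -- The equation at `i` times the conjugated equation at `n + i`, with both sides rewritten by
  -- `residue_eq`. The minus sign in the weights survives and sets the two positive forms against
  -- each other.
  have hterm : ∀ i : Fin n, (∑ l, star (α l) * (cauchyGram κ l i * α i)) * g i =
      -∑ l, star (β l) * (cauchyGram μ l i * β i) := by
    intro i
    have r1 := residue_eq h.K_inj h.star_K hA i
    have r2 := residue_eq h.Λ_inj h.star_Λ hB i
    have hk := prod_erase_sub_ne_zero h.K_inj (Fin.castAdd n i)
    have hl := prod_erase_sub_ne_zero h.Λ_inj (Fin.castAdd n i)
    have hw := h.weight (Fin.castAdd n i)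
    rw [Finset.prod_div_distrib, mirror_castAdd] at hw
    have a1 := hAB (Fin.castAdd n i)
    have a2 := congrArg star (hAB (Fin.natAdd n i))
    rw [star_add, star_mul', star_mul', star_zero] at a2
    have a3 := he i
    change _ = (-1) ^ (n + 1) * ∑ l, star (α l) * (cauchyGram κ l i * α i) at r1
    change _ = (-1) ^ (n + 1) * ∑ l, star (β l) * (cauchyGram μ l i * β i) at r2
    generalize ∑ l, star (α l) * (cauchyGram κ l i * α i) = S at *
    generalize ∑ l, star (β l) * (cauchyGram μ l i * β i) = S' at *
    generalize ∏ l ∈ Finset.univ.erase (Fin.castAdd n i), (K (Fin.castAdd n i) - K l) = dk at *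
    generalize ∏ l ∈ Finset.univ.erase (Fin.castAdd n i), (Λ (Fin.castAdd n i) - Λ l) = dl at *
    have h3 : ((-1 : ℂ)) ^ (n + 1) ≠ 0 := pow_ne_zero _ (by norm_num)
    apply mul_left_cancel₀ h3
    have : (-1) ^ (n + 1) * (S * g i) = ((-1) ^ (n + 1) * S) * g i := by ring
    rw [this, ← r1, mul_neg, ← r2]
    generalize star (A.eval (K (Fin.natAdd n i))) = p at *
    generalize star (B.eval (Λ (Fin.natAdd n i))) = q at *
    generalize A.eval (K (Fin.castAdd n i)) = p' at *
    generalize B.eval (Λ (Fin.castAdd n i)) = q' at *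
    have a6 : p' * p * (c (Fin.castAdd n i) * star (c (Fin.natAdd n i))) * g i = q' * q := by
      linear_combination (-(p' * p * (c (Fin.castAdd n i) * star (c (Fin.natAdd n i))))) * a3 +
        (p * (star (c (Fin.natAdd n i)) * star (e (Fin.natAdd n i)))) * a1 - q' * a2
    rw [hw] at a6
    field_simp at a6 ⊢
    linear_combination (-1) * a6
  have hforms : star α ⬝ᵥ (cauchyGram κ *ᵥ fun j => g j * α j) =
      -(star β ⬝ᵥ (cauchyGram μ *ᵥ β)) := by
    have e2 : star β ⬝ᵥ (cauchyGram μ *ᵥ β) =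
        star β ⬝ᵥ (cauchyGram μ *ᵥ fun j => 1 * β j) := by simp
    rw [e2, dotProduct_mulVec_mul, dotProduct_mulVec_mul, ← Finset.sum_neg_distrib]
    simp only [mul_one]
    exact Finset.sum_congr rfl fun i _ => hterm i
  have hβ0 : 0 ≤ (star β ⬝ᵥ (cauchyGram μ *ᵥ β)).re :=
    (Complex.le_def.1 ((cauchyGram_posDef μ h.re_Λ hμinj).posSemidef.dotProduct_mulVec_nonneg β)).1
  have hα0 : α = 0 := by
    by_contra hne
    have := hg α hne
    rw [hforms, Complex.neg_re] at this
    linarith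
  have hA0 : A = 0 := eq_zero_of_eval_castAdd h.K_inj hA fun i => by
    have := congrFun hα0 i
    simpa [hα, prod_erase_sub_ne_zero hκinj i] using this
  refine ⟨hA0, eq_zero_of_eval_castAdd h.Λ_inj hB fun i => ?_⟩
  simpa [hA0] using hAB (Fin.castAdd n i)

section Parameters

variable {δ : ℝ}

lemma exp_phase_exponent_im (k : ℂ) : (-2 * Complex.I * δ * k).im = -2 * δ * k.re := by
  simp [Complex.mul_im, Complex.mul_re]

lemma star_bigL (k : ℂ) : star (bigL δ k) = -bigL δ (-star k) := by
  simp only [bigL, Complex.star_def, map_mul, map_sub, map_one, ← Complex.exp_conj, Complex.conj_I]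
  have : (starRingEnd ℂ) 2 = 2 := map_ofNat _ 2
  simp [this]

/-- The real part of `L` is a positive multiple of `sin(2δ Re k)`, which is positive because `0 < 2δ
Re k < π`. It makes the Cauchy matrix of the `L_j` positive definite. -/
lemma re_bigL_pos (hδ : 0 < δ) {k : ℂ} (h0 : 0 < k.re) (h1 : k.re < Real.pi / (2 * δ)) :
    0 < (bigL δ k).re := by
  have h2 : k.re * (2 * δ) < Real.pi := by rwa [lt_div_iff₀ (by positivity)] at h1
  have h3 : (bigL δ k).re = -(Complex.exp (-2 * Complex.I * δ * k)).im := by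
    simp [bigL]
  rw [h3, Complex.exp_im, exp_phase_exponent_im,
    show -2 * δ * k.re = -(k.re * (2 * δ)) by ring, Real.sin_neg]
  have := Real.sin_pos_of_pos_of_lt_pi (by positivity) h2
  have := Real.exp_pos (-2 * Complex.I * δ * k).re
  nlinarith

/-- The exponents `-2iδk` have imaginary parts in `(-π, π)`, where `exp` is injective. -/
lemma bigL_inj (hδ : 0 < δ) {k k' : ℂ} (h : |k.re| < Real.pi / (2 * δ))
    (h' : |k'.re| < Real.pi / (2 * δ)) (heq : bigL δ k = bigL δ k') : k = k' := by
  rw [lt_div_iff₀ (by positivity)] at h h'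
  have h2 : ∀ x : ℝ, |x| * (2 * δ) < Real.pi → -Real.pi < -2 * δ * x ∧ -2 * δ * x ≤ Real.pi := by
    intro x hx
    have : |x * (2 * δ)| < Real.pi := by rwa [abs_mul, abs_of_pos (by positivity : 0 < 2 * δ)]
    obtain ⟨h3, h4⟩ := abs_lt.1 this
    constructor <;> linarith
  have h3 : Complex.exp (-2 * Complex.I * δ * k) = Complex.exp (-2 * Complex.I * δ * k') := by
    have := mul_left_cancel₀ Complex.I_ne_zero heq
    linear_combination this
  have h4 := Complex.exp_inj_of_neg_pi_lt_of_le_pi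
    (by rw [exp_phase_exponent_im]; exact (h2 _ h).1)
    (by rw [exp_phase_exponent_im]; exact (h2 _ h).2)
    (by rw [exp_phase_exponent_im]; exact (h2 _ h').1)
    (by rw [exp_phase_exponent_im]; exact (h2 _ h').2) h3
  refine mul_left_cancel₀ ?_ h4
  simp [hδ.ne']

variable {k a c : Fin (n + n) → ℂ}

lemma SolitonParameters.star_k (h : SolitonParameters δ k a c) (j : Fin (n + n)) :
    star (k j) = -k (mirror j) := by
  refine Fin.addCases (fun i => ?_) (fun i => ?_) j
  · rw [mirror_castAdd, h.conj_k]
  · rw [mirror_natAdd, ← neg_eq_iff_eq_neg, ← star_neg, ← h.conj_k, star_star]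

lemma SolitonParameters.star_a (h : SolitonParameters δ k a c) (j : Fin (n + n)) :
    star (a j) = -a (mirror j) := by
  refine Fin.addCases (fun i => ?_) (fun i => ?_) j
  · rw [mirror_castAdd, h.conj_a]
  · rw [mirror_natAdd, ← neg_eq_iff_eq_neg, ← star_neg, ← h.conj_a, star_star]

lemma SolitonParameters.re_natAdd (h : SolitonParameters δ k a c) (i : Fin n) :
    (k (Fin.natAdd n i)).re = -(k (Fin.castAdd n i)).re := by
  have := congrArg Complex.re (h.conj_k i)
  rw [Complex.neg_re, Complex.star_def, Complex.conj_re] at this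
  linarith

lemma SolitonParameters.abs_re_lt (h : SolitonParameters δ k a c) (j : Fin (n + n)) :
    |(k j).re| < Real.pi / (2 * δ) := by
  have key : ∀ i : Fin n, |(k (Fin.castAdd n i)).re| < Real.pi / (2 * δ) := fun i => by
    rw [abs_of_pos (h.re_pos i)]; exact h.re_lt i
  refine Fin.addCases (fun i => key i) (fun i => ?_) j
  rw [h.re_natAdd, abs_neg]
  exact key i

lemma SolitonParameters.k_inj (h : SolitonParameters δ k a c) : Function.Injective k := by
  have key : ∀ i l : Fin n, (k (Fin.castAdd n i)).re = (k (Fin.castAdd n l)).re → i = l := by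
    intro i l hil
    rcases lt_trichotomy i l with h1 | h1 | h1
    · exact absurd hil (h.re_anti _ _ h1).ne'
    · exact h1
    · exact absurd hil (h.re_anti _ _ h1).ne
  have hp := h.re_pos
  have hr := h.re_natAdd
  intro p q
  refine Fin.addCases (fun i => ?_) (fun i => ?_) p <;>
    refine Fin.addCases (fun l => ?_) (fun l => ?_) q <;> intro hpq <;>
    have hre := congrArg Complex.re hpq
  · rw [key i l hre]
  · rw [hr] at hre; linarith [hp i, hp l]
  · rw [hr] at hre; linarith [hp i, hp l]
  · rw [hr, hr] at hre; rw [key i l (by linarith)]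

/-- C3 distributes the factors of `∏_{l ≠ j} (L_j - L_l)/(k_j - k_l)`: those crossing between the
two halves go to `c_j`, and those within one half go, conjugated, to `c_{n+j}`. Only the product
`c_j conj(c_{n+j})` matters afterwards. -/
lemma SolitonParameters.mirrorData (hδ : 0 < δ) (h : SolitonParameters δ k a c) :
    MirrorData k (fun j => bigL δ (k j)) c := by
  have hL : ∀ j, star (bigL δ (k j)) = -bigL δ (k (mirror j)) := fun j => by
    rw [star_bigL, h.star_k, neg_neg]
  have hLinj : Function.Injective fun j => bigL δ (k j) := fun p q hpq =>
    h.k_inj (bigL_inj hδ (h.abs_re_lt p) (h.abs_re_lt q) hpq)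
  have hquot : ∀ j l, star ((bigL δ (k j) - bigL δ (k l)) / (k j - k l)) =
      (bigL δ (k (mirror j)) - bigL δ (k (mirror l))) / (k (mirror j) - k (mirror l)) := by
    intro j l
    rw [star_div₀, star_sub, star_sub, hL, hL, h.star_k, h.star_k, ← neg_div_neg_eq]
    congr 1 <;> ring
  have hc : ∀ i : Fin n, c (Fin.castAdd n i) * star (c (Fin.natAdd n i)) =
      -∏ l ∈ Finset.univ.erase (Fin.castAdd n i),
        (bigL δ (k (Fin.castAdd n i)) - bigL δ (k l)) / (k (Fin.castAdd n i) - k l) := by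
    intro i
    rw [prod_erase_castAdd, h.c_left, h.c_right, star_neg, star_prod]
    simp_rw [hquot, mirror_natAdd]
    ring
  refine ⟨h.k_inj, hLinj, h.star_k, hL, h.re_pos, fun i => re_bigL_pos hδ (h.re_pos i) (h.re_lt i),
    fun j => ?_⟩
  refine Fin.addCases (fun i => ?_) (fun i => ?_) j
  · rw [mirror_castAdd]; exact hc i
  · rw [mirror_natAdd]
    have h1 := congrArg star (hc i)
    rw [star_mul', star_star, star_neg, star_prod] at h1
    rw [mul_comm, h1, prod_erase_castAdd, prod_erase_natAdd]
    simp_rw [hquot, mirror_natAdd, mirror_castAdd]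
    ring

end Parameters

end

end INLS

/-! ### Smooth dependence and the linear problem -/

namespace INLS

noncomputable section

open Polynomial Matrix

variable {n : ℕ}

section Smooth

variable {𝕜 : Type*} [NontriviallyNormedField 𝕜] [NormedAlgebra 𝕜 ℂ]
  {G : Type*} [NormedAddCommGroup G] [NormedSpace 𝕜 G] {N : ℕ} {m : WithTop ℕ∞}

lemma contDiffAt_det {M : G → Matrix (Fin N) (Fin N) ℂ} {r : G}
    (hM : ∀ i j, ContDiffAt 𝕜 m (fun y => M y i j) r) : ContDiffAt 𝕜 m (fun y => (M y).det) r := by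
  simp only [Matrix.det_apply']
  exact ContDiffAt.sum fun σ _ => contDiffAt_const.mul (contDiffAt_prod fun i _ => hM _ _)

/-- By Cramer's rule each coordinate is a quotient of determinants. The base field is left general
because the parameter is later complex space, real time, or the vector of decaying exponentials. -/
lemma contDiffAt_inv_mulVec {M : G → Matrix (Fin N) (Fin N) ℂ} {b : G → Fin N → ℂ} {r : G}
    (hM : ∀ i j, ContDiffAt 𝕜 m (fun y => M y i j) r)
    (hb : ∀ i, ContDiffAt 𝕜 m (fun y => b y i) r) (hdet : (M r).det ≠ 0) (i : Fin N) :
    ContDiffAt 𝕜 m (fun y => ((M y)⁻¹ *ᵥ b y) i) r := by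
  have h : ∀ y, ((M y)⁻¹ *ᵥ b y) i = (M y).det⁻¹ * ((M y).updateCol i (b y)).det := fun y => by
    rw [Matrix.inv_def, Matrix.smul_mulVec, ← Matrix.cramer_eq_adjugate_mulVec, Pi.smul_apply,
      Matrix.cramer_apply, Ring.inverse_eq_inv', smul_eq_mul]
  simp only [h]
  refine ((contDiffAt_det hM).inv hdet).mul (contDiffAt_det fun p q => ?_)
  rcases eq_or_ne q i with rfl | hq
  · simpa using hb p
  · simpa [Matrix.updateCol_ne hq] using hM p q

variable {K Λ : Fin (n + n) → ℂ} {E F : G → Fin (n + n) → ℂ} {r : G}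

lemma contDiffAt_pairMatrix (l : ℕ) (hE : ∀ j, ContDiffAt 𝕜 m (fun y => E y j) r)
    (hF : ∀ j, ContDiffAt 𝕜 m (fun y => F y j) r) (i j : Fin (n + n)) :
    ContDiffAt 𝕜 m (fun y => pairMatrix l K Λ (E y) (F y) i j) r := by
  simp only [pairMatrix, Matrix.of_apply]
  split_ifs
  · exact contDiffAt_const.mul (hE i)
  · exact contDiffAt_const.mul (hF i)

lemma contDiffAt_coeffP (hE : ∀ j, ContDiffAt 𝕜 m (fun y => E y j) r)
    (hF : ∀ j, ContDiffAt 𝕜 m (fun y => F y j) r)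
    (hdet : (pairMatrix n K Λ (E r) (F r)).det ≠ 0) (i : Fin (n + n)) :
    ContDiffAt 𝕜 m (fun y => coeffP K Λ (E y) (F y) i) r :=
  contDiffAt_inv_mulVec (contDiffAt_pairMatrix n hE hF)
    (fun j => (contDiffAt_const.mul (hE j)).neg) hdet i

lemma contDiffAt_coeffQ (hE : ∀ j, ContDiffAt 𝕜 m (fun y => E y j) r)
    (hF : ∀ j, ContDiffAt 𝕜 m (fun y => F y j) r)
    (hdet : (pairMatrix n K Λ (E r) (F r)).det ≠ 0) (i : Fin (n + n)) :
    ContDiffAt 𝕜 m (fun y => coeffQ K Λ (E y) (F y) i) r :=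
  contDiffAt_inv_mulVec (contDiffAt_pairMatrix n hE hF)
    (fun j => (contDiffAt_const.mul (hF j)).neg) hdet i

lemma hasDerivAt_eval_ofCoeffs {f : 𝕜 → Fin n → ℂ} {f' : Fin n → ℂ} {y : 𝕜}
    (hf : ∀ q, HasDerivAt (fun s => f s q) (f' q) y) (κ : ℂ) :
    HasDerivAt (fun s => (ofCoeffs (f s)).eval κ) ((ofCoeffs f').eval κ) y := by
  simp only [eval_ofCoeffs]
  exact HasDerivAt.fun_sum fun q _ => (hf q).mul_const _

end Smooth

/-- Multiplication by `X` can raise the degree to exactly `n`. Subtracting the former top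
coefficient times a monic polynomial removes that term and brings the difference back under the
uniqueness principle. -/
lemma degree_X_mul_sub_lt (hn : 1 ≤ n) (f g : Fin n → ℂ) :
    (X * ofCoeffs f - C (f ⟨n - 1, by omega⟩) * (X ^ n + ofCoeffs g)).degree < (n : WithBot ℕ) := by
  rw [degree_lt_iff_coeff_zero]
  intro m hm
  obtain ⟨m, rfl⟩ : ∃ l, m = l + 1 := ⟨m - 1, by omega⟩
  have h1 : ∀ f : Fin n → ℂ, (ofCoeffs f).coeff (m + 1) = 0 := fun f =>
    coeff_eq_zero_of_degree_lt ((degree_ofCoeffs_lt f).trans_le (by exact_mod_cast hm))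
  rw [coeff_sub, coeff_X_mul, coeff_C_mul, coeff_add, h1, coeff_X_pow, add_zero]
  split_ifs with h
  · rw [mul_one, sub_eq_zero]
    have := coeff_ofCoeffs f ⟨n - 1, by omega⟩
    rw [← this]
    congr 1
    simp only; omega
  · rw [mul_zero, sub_zero]
    exact coeff_eq_zero_of_degree_lt ((degree_ofCoeffs_lt f).trans_le
      (by exact_mod_cast (by omega : n ≤ m)))

/-- The `x`-equation of the linear problem. -/
lemma deriv_relation (hn : 1 ≤ n) {K Λ : Fin (n + n) → ℂ} {E : Fin (n + n) → ℂ}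
    (hdet : (pairMatrix n K Λ E 1).det ≠ 0) (f' : Fin (n + n) → ℂ)
    (h : ∀ j, (ofCoeffs fun q => f' (Fin.castAdd n q)).eval (K j) * E j +
      (ofCoeffs fun q => coeffQ K Λ E 1 (Fin.castAdd n q)).eval (K j) * (K j * E j) +
      (ofCoeffs fun q => f' (Fin.natAdd n q)).eval (Λ j) = 0) (κ : ℂ) :
    (ofCoeffs fun q => f' (Fin.castAdd n q)).eval κ +
      κ * (ofCoeffs fun q => coeffQ K Λ E 1 (Fin.castAdd n q)).eval κ =
    coeffQ K Λ E 1 (Fin.castAdd n ⟨n - 1, by omega⟩) *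
      (κ ^ n + (ofCoeffs fun q => coeffP K Λ E 1 (Fin.castAdd n q)).eval κ) := by
  set v := coeffQ K Λ E 1 (Fin.castAdd n ⟨n - 1, by omega⟩) with hv
  -- The `x`-derivative of the `coeffQ` pair, first member completed by `X` times itself, solves the
  -- same node equations. Subtracting `v` times the `coeffP` pair lowers the degrees, so the
  -- remainder is zero.
  have key := ((det_pairMatrix_ne_zero_iff K Λ E 1).1 hdet
    ((ofCoeffs fun q => f' (Fin.castAdd n q)) +
      (X * (ofCoeffs fun q => coeffQ K Λ E 1 (Fin.castAdd n q)) -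
        C v * (X ^ n + ofCoeffs fun q => coeffP K Λ E 1 (Fin.castAdd n q))))
    ((ofCoeffs fun q => f' (Fin.natAdd n q)) -
      C v * ofCoeffs fun q => coeffP K Λ E 1 (Fin.natAdd n q))
    ((degree_add_le _ _).trans_lt (max_lt (degree_ofCoeffs_lt _) (degree_X_mul_sub_lt hn _ _)))
    ((degree_sub_le _ _).trans_lt (max_lt (degree_ofCoeffs_lt _)
      ((degree_mul_le_of_le degree_C_le le_rfl).trans_lt
        (by rw [zero_add]; exact degree_ofCoeffs_lt _))))
    fun j => by
      have h1 := h j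
      have h2 := coeffP_spec hdet j
      simp only [eval_add, eval_sub, eval_mul, eval_X, eval_C, eval_pow, Pi.one_apply, mul_one]
        at h2 ⊢
      linear_combination h1 - v * h2).1
  have := congrArg (fun p => p.eval κ) key
  simp only [eval_add, eval_sub, eval_mul, eval_X, eval_C, eval_pow, eval_zero] at this
  linear_combination this

/-- The `t`-equation, combined with the `x`-equation. -/
lemma time_relation {K Λ : Fin (n + n) → ℂ} {E : Fin (n + n) → ℂ}
    (hdet : (pairMatrix n K Λ E 1).det ≠ 0) (v v' : ℂ) (qx qxx qt px : Fin (n + n) → ℂ)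
    (hx : ∀ κ, (ofCoeffs fun q => qx (Fin.castAdd n q)).eval κ +
      κ * (ofCoeffs fun q => coeffQ K Λ E 1 (Fin.castAdd n q)).eval κ =
      v * (κ ^ n + (ofCoeffs fun q => coeffP K Λ E 1 (Fin.castAdd n q)).eval κ))
    (hxx : ∀ κ, (ofCoeffs fun q => qxx (Fin.castAdd n q)).eval κ +
      κ * (ofCoeffs fun q => qx (Fin.castAdd n q)).eval κ =
      v' * (κ ^ n + (ofCoeffs fun q => coeffP K Λ E 1 (Fin.castAdd n q)).eval κ) +
        v * (ofCoeffs fun q => px (Fin.castAdd n q)).eval κ)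
    (hp : ∀ j, (ofCoeffs fun q => px (Fin.castAdd n q)).eval (K j) * E j +
      (K j ^ n + (ofCoeffs fun q => coeffP K Λ E 1 (Fin.castAdd n q)).eval (K j)) * (K j * E j) +
      (ofCoeffs fun q => px (Fin.natAdd n q)).eval (Λ j) = 0)
    (ht : ∀ j, (ofCoeffs fun q => qt (Fin.castAdd n q)).eval (K j) * E j +
      (ofCoeffs fun q => coeffQ K Λ E 1 (Fin.castAdd n q)).eval (K j) *
        (Complex.I * K j ^ 2 * E j) +
      (ofCoeffs fun q => qt (Fin.natAdd n q)).eval (Λ j) = 0) (q : Fin n) :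
    qt (Fin.castAdd n q) + Complex.I * qxx (Fin.castAdd n q) -
      2 * Complex.I * v * px (Fin.castAdd n q) = 0 := by
  have hC : ∀ (z : ℂ) (f : Fin n → ℂ), (C z * ofCoeffs f).degree < n := fun z f =>
    (degree_mul_le_of_le degree_C_le le_rfl).trans_lt (by rw [zero_add]; exact degree_ofCoeffs_lt _)
  -- The `t`-derivative leaves the term `i K_j² Q(K_j) E_j`. Applying the `x`-equation twice turns
  -- it into `q_xx`, `p_x` and multiples of the `coeffP` pair, leaving a pair of degrees below `n`
  -- that solves the homogeneous system.
  have key := ((det_pairMatrix_ne_zero_iff K Λ E 1).1 hdet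
    ((ofCoeffs fun q => qt (Fin.castAdd n q)) +
      C Complex.I * (ofCoeffs fun q => qxx (Fin.castAdd n q)) -
      C (2 * Complex.I * v) * (ofCoeffs fun q => px (Fin.castAdd n q)))
    ((ofCoeffs fun q => qt (Fin.natAdd n q)) -
      C (Complex.I * v) * (ofCoeffs fun q => px (Fin.natAdd n q)) +
      C (Complex.I * v') * (ofCoeffs fun q => coeffP K Λ E 1 (Fin.natAdd n q)))
    ((degree_sub_le _ _).trans_lt (max_lt ((degree_add_le _ _).trans_lt
      (max_lt (degree_ofCoeffs_lt _) (hC _ _))) (hC _ _)))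
    ((degree_add_le _ _).trans_lt (max_lt ((degree_sub_le _ _).trans_lt
      (max_lt (degree_ofCoeffs_lt _) (hC _ _))) (hC _ _)))
    fun j => by
      have h1 := hx (K j)
      have h2 := hxx (K j)
      have h3 := hp j
      have h4 := ht j
      have h5 := coeffP_spec hdet j
      simp only [eval_add, eval_sub, eval_mul, eval_X, eval_C, eval_pow, Pi.one_apply, mul_one]
        at h5 ⊢
      linear_combination h4 - Complex.I * v * h3 + Complex.I * v' * h5 - Complex.I * K j * E j * h1
        + Complex.I * E j * h2).1
  have := congrArg (fun p => p.coeff q) key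
  simpa only [coeff_add, coeff_sub, coeff_C_mul, coeff_ofCoeffs, coeff_zero] using this

/-- The relation between the solutions for `E` and for the shifted data `(1 - iΛ) E`. -/
lemma shift_relation (hn : 1 ≤ n) {K Λ : Fin (n + n) → ℂ} {E E' : Fin (n + n) → ℂ}
    (hE : ∀ j, E' j = (1 - Complex.I * Λ j) * E j) (hdet : (pairMatrix n K Λ E 1).det ≠ 0)
    (hdet' : (pairMatrix n K Λ E' 1).det ≠ 0) (q : Fin n) :
    coeffP K Λ E 1 (Fin.castAdd n q) - coeffP K Λ E' 1 (Fin.castAdd n q) +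
      Complex.I * coeffP K Λ E 1 (Fin.natAdd n ⟨n - 1, by omega⟩) *
        coeffQ K Λ E' 1 (Fin.castAdd n q) = 0 := by
  set w := coeffP K Λ E 1 (Fin.natAdd n ⟨n - 1, by omega⟩) with hw
  have hC : ∀ (z : ℂ) (f : Fin n → ℂ), (C z * ofCoeffs f).degree < n := fun z f =>
    (degree_mul_le_of_le degree_C_le le_rfl).trans_lt (by rw [zero_add]; exact degree_ofCoeffs_lt _)
  have hdeg := degree_X_mul_sub_lt hn (fun q => coeffP K Λ E 1 (Fin.natAdd n q))
    (fun q => coeffQ K Λ E' 1 (Fin.natAdd n q))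
  -- Multiplying the `coeffP` equations for `E` by `1 - iΛ_j` gives equations for `E'`, at the cost
  -- of a term of degree `n` in the second member. The `coeffQ` pair for `E'`, weighted by `i w`,
  -- cancels it.
  have key := ((det_pairMatrix_ne_zero_iff K Λ E' 1).1 hdet'
    ((ofCoeffs fun q => coeffP K Λ E 1 (Fin.castAdd n q)) -
      (ofCoeffs fun q => coeffP K Λ E' 1 (Fin.castAdd n q)) +
      C (Complex.I * w) * (ofCoeffs fun q => coeffQ K Λ E' 1 (Fin.castAdd n q)))
    ((ofCoeffs fun q => coeffP K Λ E 1 (Fin.natAdd n q)) -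
      (ofCoeffs fun q => coeffP K Λ E' 1 (Fin.natAdd n q)) -
      C Complex.I * (X * (ofCoeffs fun q => coeffP K Λ E 1 (Fin.natAdd n q)) -
        C w * (X ^ n + ofCoeffs fun q => coeffQ K Λ E' 1 (Fin.natAdd n q))))
    ((degree_add_le _ _).trans_lt (max_lt ((degree_sub_le _ _).trans_lt
      (max_lt (degree_ofCoeffs_lt _) (degree_ofCoeffs_lt _))) (hC _ _)))
    ((degree_sub_le _ _).trans_lt (max_lt ((degree_sub_le _ _).trans_lt
      (max_lt (degree_ofCoeffs_lt _) (degree_ofCoeffs_lt _)))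
        ((degree_mul_le_of_le degree_C_le le_rfl).trans_lt (by rw [zero_add]; exact hdeg))))
    fun j => by
      have h1 := coeffP_spec hdet j
      have h2 := coeffP_spec hdet' j
      have h3 := coeffQ_spec hdet' j
      simp only [eval_add, eval_sub, eval_mul, eval_X, eval_C, eval_pow, Pi.one_apply, mul_one]
        at h1 h2 h3 ⊢
      have h4 := hE j
      linear_combination (1 - Complex.I * Λ j) * h1 - h2 + Complex.I * w * h3 +
        (K j ^ n + eval (K j) (ofCoeffs fun q => coeffP K Λ E 1 (Fin.castAdd n q))) * h4).1
  have := congrArg (fun p => p.coeff q) key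
  simpa only [coeff_add, coeff_sub, coeff_C_mul, coeff_ofCoeffs, coeff_zero] using this

end

end INLS

/-! ### The exponential data and the evolution equation -/

namespace INLS

noncomputable section

open Polynomial Matrix

variable {n : ℕ}

/-- The exponential factors `c_j e^{λ_j}`. -/
def expFactor (δ ξ : ℝ) (k a c : Fin (n + n) → ℂ) (x : ℂ) (t : ℝ) (j : Fin (n + n)) : ℂ :=
  c j * Complex.exp (phase δ ξ (k j) (a j) x t)

variable (δ ξ : ℝ) (k a c : Fin (n + n) → ℂ)

lemma tau_eq (x : ℂ) (t : ℝ) : tau δ ξ k a c x t =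
    (pairMatrix n k (fun j => bigL δ (k j)) (expFactor δ ξ k a c x t) 1).det := by
  rw [tau, wronskiMatrix_eq]; rfl

lemma w21_eq (hn : 1 ≤ n) (x : ℂ) (t : ℝ) : w21 δ ξ k a c x t =
    coeffQ k (fun j => bigL δ (k j)) (expFactor δ ξ k a c x t) 1
      (Fin.castAdd n ⟨n - 1, by omega⟩) := by
  rw [coeffQ_top hn, w21, tau_eq, wronskiMatrix_eq]; rfl

lemma hasDerivAt_expFactor (x : ℂ) (t : ℝ) (j : Fin (n + n)) :
    HasDerivAt (fun y => expFactor δ ξ k a c y t j) (k j * expFactor δ ξ k a c x t j) x := by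
  have h : HasDerivAt (fun y => phase δ ξ (k j) (a j) y t) (k j) x := by
    have := ((((hasDerivAt_id x).const_mul (k j)).const_add ((k j - bigL δ (k j)) * ξ)).add_const
      (Complex.I * k j ^ 2 * t)).add_const (a j)
    simpa [phase] using this
  have := (h.cexp).const_mul (c j)
  refine this.congr_deriv ?_
  rw [expFactor]; ring

lemma hasDerivAt_expFactor_time (x : ℂ) (t : ℝ) (j : Fin (n + n)) :
    HasDerivAt (fun s => expFactor δ ξ k a c x s j)
      (Complex.I * k j ^ 2 * expFactor δ ξ k a c x t j) t := by
  have h : HasDerivAt (fun s => phase δ ξ (k j) (a j) x s) (Complex.I * k j ^ 2) t := by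
    have := (((Complex.ofRealCLM.hasDerivAt (x := t)).const_mul (Complex.I * k j ^ 2)).const_add
      ((k j - bigL δ (k j)) * ξ + k j * x)).add_const (a j)
    simpa [phase] using this
  have := (h.cexp).const_mul (c j)
  refine this.congr_deriv ?_
  rw [expFactor]; ring

lemma contDiff_expFactor (t : ℝ) (j : Fin (n + n)) :
    ContDiff ℂ 1 (fun y => expFactor δ ξ k a c y t j) := by
  simp only [expFactor, phase]
  fun_prop

lemma contDiff_expFactor_time (x : ℂ) (j : Fin (n + n)) :
    ContDiff ℝ 1 (fun s => expFactor δ ξ k a c x s j) := by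
  simp only [expFactor, phase]
  have : ContDiff ℝ 1 (fun s : ℝ => (s : ℂ)) := Complex.ofRealCLM.contDiff
  fun_prop

variable {δ ξ k a c}

section

variable {Λ : Fin (n + n) → ℂ} {x : ℂ} {t : ℝ}

lemma isOpen_det_ne_zero (Λ : Fin (n + n) → ℂ) (t : ℝ) :
    IsOpen {y | (pairMatrix n k Λ (expFactor δ ξ k a c y t) 1).det ≠ 0} := by
  refine isOpen_ne_fun (ContDiff.continuous (𝕜 := ℂ) (n := 1) (contDiff_iff_contDiffAt.2 fun y => ?_))
    continuous_const
  exact contDiffAt_det (contDiffAt_pairMatrix n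
    (fun j => (contDiff_expFactor δ ξ k a c t j).contDiffAt) fun j => contDiffAt_const)

lemma isOpen_det_ne_zero_time (Λ : Fin (n + n) → ℂ) (x : ℂ) :
    IsOpen {s | (pairMatrix n k Λ (expFactor δ ξ k a c x s) 1).det ≠ 0} := by
  refine isOpen_ne_fun (ContDiff.continuous (𝕜 := ℝ) (n := 1) (contDiff_iff_contDiffAt.2 fun y => ?_))
    continuous_const
  exact contDiffAt_det (contDiffAt_pairMatrix n
    (fun j => (contDiff_expFactor_time δ ξ k a c x j).contDiffAt) fun j => contDiffAt_const)

lemma differentiableAt_coeffP (h : (pairMatrix n k Λ (expFactor δ ξ k a c x t) 1).det ≠ 0)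
    (i : Fin (n + n)) :
    DifferentiableAt ℂ (fun y => coeffP k Λ (expFactor δ ξ k a c y t) 1 i) x :=
  (contDiffAt_coeffP (m := 1) (fun j => (contDiff_expFactor δ ξ k a c t j).contDiffAt)
    (fun _ => contDiffAt_const) h i).differentiableAt one_ne_zero

lemma differentiableAt_coeffQ (h : (pairMatrix n k Λ (expFactor δ ξ k a c x t) 1).det ≠ 0)
    (i : Fin (n + n)) :
    DifferentiableAt ℂ (fun y => coeffQ k Λ (expFactor δ ξ k a c y t) 1 i) x :=
  (contDiffAt_coeffQ (m := 1) (fun j => (contDiff_expFactor δ ξ k a c t j).contDiffAt)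
    (fun _ => contDiffAt_const) h i).differentiableAt one_ne_zero

lemma differentiableAt_coeffQ_time (h : (pairMatrix n k Λ (expFactor δ ξ k a c x t) 1).det ≠ 0)
    (i : Fin (n + n)) :
    DifferentiableAt ℝ (fun s => coeffQ k Λ (expFactor δ ξ k a c x s) 1 i) t :=
  (contDiffAt_coeffQ (m := 1) (fun j => (contDiff_expFactor_time δ ξ k a c x j).contDiffAt)
    (fun _ => contDiffAt_const) h i).differentiableAt one_ne_zero

lemma differentiableAt_deriv_coeffQ
    (h : (pairMatrix n k Λ (expFactor δ ξ k a c x t) 1).det ≠ 0) (i : Fin (n + n)) :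
    DifferentiableAt ℂ (deriv fun y => coeffQ k Λ (expFactor δ ξ k a c y t) 1 i) x := by
  have hU := isOpen_det_ne_zero (δ := δ) (ξ := ξ) (k := k) (a := a) (c := c) Λ t
  have h1 : DifferentiableOn ℂ (fun y => coeffQ k Λ (expFactor δ ξ k a c y t) 1 i) _ :=
    fun y (hy : y ∈ {y | (pairMatrix n k Λ (expFactor δ ξ k a c y t) 1).det ≠ 0}) =>
      (differentiableAt_coeffQ hy i).differentiableWithinAt
  exact (h1.deriv hU).differentiableAt (hU.mem_nhds h)

/-- The evolution equation `i v_t = v_xx - 2 v p_x` for the leading coefficients. -/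
lemma evolution_equation (hn : 1 ≤ n)
    (h : (pairMatrix n k Λ (expFactor δ ξ k a c x t) 1).det ≠ 0) (q : Fin n) :
    deriv (fun s => coeffQ k Λ (expFactor δ ξ k a c x s) 1 (Fin.castAdd n q)) t +
      Complex.I * deriv (deriv fun y => coeffQ k Λ (expFactor δ ξ k a c y t) 1 (Fin.castAdd n q)) x -
      2 * Complex.I *
        coeffQ k Λ (expFactor δ ξ k a c x t) 1 (Fin.castAdd n ⟨n - 1, by omega⟩) *
        deriv (fun y => coeffP k Λ (expFactor δ ξ k a c y t) 1 (Fin.castAdd n q)) x = 0 := by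
  have hU := isOpen_det_ne_zero (δ := δ) (ξ := ξ) (k := k) (a := a) (c := c) Λ t
  set U := {y | (pairMatrix n k Λ (expFactor δ ξ k a c y t) 1).det ≠ 0} with hUdef
  have hUx : ∀ᶠ y in 𝓝 x, y ∈ U := hU.mem_nhds h
  have hQ : ∀ y ∈ U, ∀ i, HasDerivAt (fun y => coeffQ k Λ (expFactor δ ξ k a c y t) 1 i)
      (deriv (fun y => coeffQ k Λ (expFactor δ ξ k a c y t) 1 i) y) y :=
    fun y hy i => (differentiableAt_coeffQ hy i).hasDerivAt
  have hP : ∀ i, HasDerivAt (fun y => coeffP k Λ (expFactor δ ξ k a c y t) 1 i)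
      (deriv (fun y => coeffP k Λ (expFactor δ ξ k a c y t) 1 i) x) x :=
    fun i => (differentiableAt_coeffP h i).hasDerivAt
  -- The node equations hold on an open set, so their derivatives vanish. The relation is needed
  -- near `x`, not only at `x`, because it is differentiated once more below.
  have hx : ∀ y ∈ U, ∀ κ, _ := fun y (hy : y ∈ U) κ => deriv_relation hn hy
    (fun i => deriv (fun y => coeffQ k Λ (expFactor δ ξ k a c y t) 1 i) y) (fun j => by
      have h1 := (((hasDerivAt_eval_ofCoeffs (fun q : Fin n => hQ y hy (Fin.castAdd n q)) (k j)).mul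
        (hasDerivAt_expFactor δ ξ k a c y t j)).add
        (hasDerivAt_eval_ofCoeffs (fun q : Fin n => hQ y hy (Fin.natAdd n q)) (Λ j))).const_add
          (Λ j ^ n)
      refine h1.unique (HasDerivAt.congr_of_eventuallyEq (hasDerivAt_const y (0 : ℂ)) ?_)
      filter_upwards [hU.mem_nhds hy] with z hz
      have h2 := coeffQ_spec hz j
      simp only [eval_add, eval_pow, eval_X, Pi.one_apply, mul_one] at h2
      simp only [Pi.add_apply, Pi.mul_apply]
      linear_combination h2) κ
  refine time_relation h _
    (deriv (fun y => coeffQ k Λ (expFactor δ ξ k a c y t) 1 (Fin.castAdd n ⟨n - 1, by omega⟩)) x)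
    (fun i => deriv (fun y => coeffQ k Λ (expFactor δ ξ k a c y t) 1 i) x)
    (fun i => deriv (deriv fun y => coeffQ k Λ (expFactor δ ξ k a c y t) 1 i) x)
    (fun i => deriv (fun s => coeffQ k Λ (expFactor δ ξ k a c x s) 1 i) t)
    (fun i => deriv (fun y => coeffP k Λ (expFactor δ ξ k a c y t) 1 i) x)
    (hx x h) (fun κ => ?_) (fun j => ?_) (fun j => ?_) q
  · have h1 := (hasDerivAt_eval_ofCoeffs (fun q : Fin n =>
      (differentiableAt_deriv_coeffQ h (Fin.castAdd n q)).hasDerivAt) κ).add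
        ((hasDerivAt_eval_ofCoeffs (fun q : Fin n => hQ x h (Fin.castAdd n q)) κ).const_mul κ)
    have h2 := (hQ x h (Fin.castAdd n ⟨n - 1, by omega⟩)).mul
      ((hasDerivAt_eval_ofCoeffs (fun q : Fin n => hP (Fin.castAdd n q)) κ).const_add (κ ^ n))
    refine h1.unique (h2.congr_of_eventuallyEq ?_)
    filter_upwards [hUx] with y hy
    exact hx y hy κ
  · have h1 := (((hasDerivAt_eval_ofCoeffs (fun q : Fin n => hP (Fin.castAdd n q)) (k j)).const_add
        (k j ^ n)).mul (hasDerivAt_expFactor δ ξ k a c x t j)).add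
        (hasDerivAt_eval_ofCoeffs (fun q : Fin n => hP (Fin.natAdd n q)) (Λ j))
    refine h1.unique (HasDerivAt.congr_of_eventuallyEq (hasDerivAt_const x (0 : ℂ)) ?_)
    filter_upwards [hUx] with z hz
    have h2 := coeffP_spec hz j
    simp only [eval_add, eval_pow, eval_X, Pi.one_apply, mul_one] at h2
    simpa only [Pi.add_apply, Pi.mul_apply] using h2
  · have hT : ∀ i, HasDerivAt (fun s => coeffQ k Λ (expFactor δ ξ k a c x s) 1 i)
        (deriv (fun s => coeffQ k Λ (expFactor δ ξ k a c x s) 1 i) t) t :=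
      fun i => (differentiableAt_coeffQ_time h i).hasDerivAt
    have h1 := (((hasDerivAt_eval_ofCoeffs (fun q : Fin n => hT (Fin.castAdd n q)) (k j)).mul
        (hasDerivAt_expFactor_time δ ξ k a c x t j)).add
        (hasDerivAt_eval_ofCoeffs (fun q : Fin n => hT (Fin.natAdd n q)) (Λ j))).const_add
          (Λ j ^ n)
    refine h1.unique (HasDerivAt.congr_of_eventuallyEq (hasDerivAt_const t (0 : ℂ)) ?_)
    filter_upwards [(isOpen_det_ne_zero_time (δ := δ) (ξ := ξ) (k := k) (a := a) (c := c) Λ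
      x).mem_nhds h] with z hz
    have h2 := coeffQ_spec hz j
    simp only [eval_add, eval_pow, eval_X, Pi.one_apply, mul_one] at h2
    simp only [Pi.add_apply, Pi.mul_apply]
    linear_combination h2

end

end

end INLS

/-! ### The contour integral of `φ coth` around the strip -/

namespace INLS

noncomputable section

-- The zeros are `2δ i m` with `m` an integer, and only `m = 0, 1` fit in the closed strip. Both lie
-- on its boundary, so only continuity is required of the quotient there.
open Complex in
lemma sinh_eq_zero_of_strip {δ : ℝ} (hδ : 0 < δ) {z : ℂ} (h0 : 0 ≤ z.im) (h1 : z.im ≤ 2 * δ)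
    (h : Complex.sinh ((Real.pi / (2 * δ) : ℝ) * z) = 0) : z = 0 ∨ z = 2 * δ * Complex.I := by
  have hc : 0 < Real.pi / (2 * δ) := by positivity
  set c := Real.pi / (2 * δ) with hcdef
  have h2 : Complex.sin (((c : ℝ) * z) * I) = 0 := by rw [Complex.sin_mul_I, h, zero_mul]
  obtain ⟨m, hm⟩ := Complex.sin_eq_zero_iff.1 h2
  have hre : z.re = 0 := by
    have := congrArg Complex.im hm
    simp at this
    rcases this with h | h
    · exact absurd h hc.ne'
    · exact h
  have him : -(c * z.im) = m * Real.pi := by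
    have := congrArg Complex.re hm
    simpa using this
  have hcd : c * (2 * δ) = Real.pi := by rw [hcdef]; field_simp
  have hm0 : (m : ℝ) ≤ 0 := by
    have : (m : ℝ) * Real.pi ≤ 0 := by rw [← him]; nlinarith
    nlinarith [Real.pi_pos]
  have hm1 : (-1 : ℝ) ≤ m := by
    have : -Real.pi ≤ (m : ℝ) * Real.pi := by rw [← him, ← hcd]; nlinarith
    nlinarith [Real.pi_pos]
  have hm0' : m ≤ 0 := by exact_mod_cast hm0
  have hm1' : -1 ≤ m := by exact_mod_cast hm1
  have : m = 0 ∨ m = -1 := by omega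
  rcases this with rfl | rfl
  · left
    apply Complex.ext
    · exact hre
    · have : c * z.im = 0 := by simpa using him
      simpa [hc.ne'] using this
  · right
    apply Complex.ext
    · simp [hre]
    · have : c * z.im = c * (2 * δ) := by rw [hcd]; simpa using him
      simpa using mul_left_cancel₀ hc.ne' this

/-- The quotient `φ cosh / sinh`, with the removable singularities filled in. -/
def cothQuotient (c : ℝ) (φ : ℂ → ℂ) (z : ℂ) : ℂ :=
  if Complex.sinh (c * z) = 0 then deriv φ z / c else
    φ z * (Complex.cosh (c * z) / Complex.sinh (c * z))

lemma hasDerivAt_sinh_mul (c : ℝ) (z : ℂ) :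
    HasDerivAt (fun w : ℂ => Complex.sinh (c * w)) (c * Complex.cosh (c * z)) z := by
  have := ((hasDerivAt_id z).const_mul (c : ℂ)).csinh
  refine this.congr_deriv ?_
  simp [mul_comm]

lemma cosh_ne_zero_of_sinh_eq_zero {w : ℂ} (h : Complex.sinh w = 0) : Complex.cosh w ≠ 0 := by
  intro h'
  have := Complex.cosh_sq_sub_sinh_sq w
  rw [h, h'] at this
  simp at this

lemma differentiableAt_cothQuotient {c : ℝ} {φ : ℂ → ℂ} {z : ℂ} (hφ : DifferentiableAt ℂ φ z)
    (hs : Complex.sinh (c * z) ≠ 0) : DifferentiableAt ℂ (cothQuotient c φ) z := by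
  have h1 : ∀ᶠ w in 𝓝 z, Complex.sinh (c * w) ≠ 0 :=
    (hasDerivAt_sinh_mul c z).continuousAt.eventually_ne hs
  have h2 : DifferentiableAt ℂ
      (fun w => φ w * (Complex.cosh (c * w) / Complex.sinh (c * w))) z := by
    refine hφ.mul (DifferentiableAt.div ?_ (hasDerivAt_sinh_mul c z).differentiableAt hs)
    fun_prop
  refine h2.congr_of_eventuallyEq ?_
  filter_upwards [h1] with w hw
  rw [cothQuotient, if_neg hw]

/-- The zeros of `sinh` are simple and `φ` vanishes there, so the limit is a ratio of slopes, which
is the default value built into `cothQuotient`. -/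
lemma continuousAt_cothQuotient {c : ℝ} (hc : c ≠ 0) {φ : ℂ → ℂ} {z : ℂ}
    (hφ : DifferentiableAt ℂ φ z) (h0 : Complex.sinh (c * z) = 0 → φ z = 0) :
    ContinuousAt (cothQuotient c φ) z := by
  by_cases hs : Complex.sinh (c * z) = 0
  · have hφz := h0 hs
    have hc' : (c : ℂ) ≠ 0 := by exact_mod_cast hc
    have hcosh := cosh_ne_zero_of_sinh_eq_zero hs
    rw [continuousAt_iff_punctured_nhds]
    have hd := hasDerivAt_iff_tendsto_slope.1 (hasDerivAt_sinh_mul c z)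
    have hn := hasDerivAt_iff_tendsto_slope.1 hφ.hasDerivAt
    have hco : Tendsto (fun w : ℂ => Complex.cosh (c * w)) (𝓝[≠] z) (𝓝 (Complex.cosh (c * z))) :=
      ((Complex.continuous_cosh.comp (continuous_const.mul continuous_id)).tendsto z).mono_left
        nhdsWithin_le_nhds
    have hlim := (hn.div hd (mul_ne_zero hc' hcosh)).mul hco
    have hval : cothQuotient c φ z = deriv φ z / (c * Complex.cosh (c * z)) *
        Complex.cosh (c * z) := by
      rw [cothQuotient, if_pos hs]; field_simp
    rw [hval]
    refine hlim.congr' ?_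
    filter_upwards [(hasDerivAt_sinh_mul c z).eventually_ne (c := 0) (mul_ne_zero hc' hcosh),
      self_mem_nhdsWithin] with w hw hwz
    have hwz' : w - z ≠ 0 := sub_ne_zero.2 hwz
    rw [cothQuotient, if_neg hw]
    simp only [Pi.div_apply, slope_def_field, hs, hφz, sub_zero]
    field_simp
  · exact (differentiableAt_cothQuotient hφ hs).continuousAt

variable {δ : ℝ}

lemma half_period (hδ : 0 < δ) (z : ℂ) :
    ((Real.pi / (2 * δ) : ℝ) : ℂ) * (2 * δ * Complex.I - z) =
      Real.pi * Complex.I - ((Real.pi / (2 * δ) : ℝ) : ℂ) * z := by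
  have : (δ : ℂ) ≠ 0 := by exact_mod_cast hδ.ne'
  push_cast
  field_simp

/-- Under `z ↦ 2δi - z` the argument becomes `πi` minus itself, which preserves `sinh` and reverses
`cosh`. -/
lemma cothQuotient_reflect (hδ : 0 < δ) {φ : ℂ → ℂ}
    (hφ : ∀ z, φ (2 * δ * Complex.I - z) = φ z) (z : ℂ) :
    cothQuotient (Real.pi / (2 * δ)) φ (2 * δ * Complex.I - z) =
      -cothQuotient (Real.pi / (2 * δ)) φ z := by
  have hs : Complex.sinh (((Real.pi / (2 * δ) : ℝ) : ℂ) * (2 * δ * Complex.I - z)) =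
      Complex.sinh (((Real.pi / (2 * δ) : ℝ) : ℂ) * z) := by
    rw [half_period hδ, Complex.sinh_sub, Complex.sinh_mul_I, Complex.cosh_mul_I]
    simp
  have hc : Complex.cosh (((Real.pi / (2 * δ) : ℝ) : ℂ) * (2 * δ * Complex.I - z)) =
      -Complex.cosh (((Real.pi / (2 * δ) : ℝ) : ℂ) * z) := by
    rw [half_period hδ, Complex.cosh_sub, Complex.sinh_mul_I, Complex.cosh_mul_I]
    simp
  have hd : deriv φ (2 * δ * Complex.I - z) = -deriv φ z := by
    have h1 : deriv (fun w => φ (2 * δ * Complex.I - w)) z =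
        -deriv φ (2 * δ * Complex.I - z) := deriv_comp_const_sub _ _ _
    rw [funext hφ] at h1
    rw [h1, neg_neg]
  rw [cothQuotient, cothQuotient, hs, hc, hφ, hd]
  split_ifs <;> ring

/-- The contour integral of `φ coth` around the rectangle, reduced by the reflection symmetry. -/
lemma integral_cothQuotient (hδ : 0 < δ) {φ : ℂ → ℂ}
    (hd : ∀ z : ℂ, 0 ≤ z.im → z.im ≤ 2 * δ → DifferentiableAt ℂ φ z)
    (hφ : ∀ z, φ (2 * δ * Complex.I - z) = φ z) (h0 : φ 0 = 0) (R : ℝ) :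
    ∫ x in (-R)..R, cothQuotient (Real.pi / (2 * δ)) φ x =
      -Complex.I * ∫ y in (0 : ℝ)..(2 * δ),
        cothQuotient (Real.pi / (2 * δ)) φ (R + y * Complex.I) := by
  have hc : Real.pi / (2 * δ) ≠ 0 := by positivity
  set H := cothQuotient (Real.pi / (2 * δ)) φ with hH
  have h2 : φ (2 * δ * Complex.I) = 0 := by
    have := hφ 0
    rwa [sub_zero, h0] at this
  have hcont : ∀ z : ℂ, 0 ≤ z.im → z.im ≤ 2 * δ → ContinuousAt H z := fun z hz0 hz1 =>
    continuousAt_cothQuotient hc (hd z hz0 hz1) fun hs => by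
      rcases sinh_eq_zero_of_strip hδ hz0 hz1 hs with rfl | rfl
      · exact h0
      · exact h2
  have rect := Complex.integral_boundary_rect_eq_zero_of_continuousOn_of_differentiableOn H
    (-R : ℂ) (R + (2 * δ : ℝ) * Complex.I) ?_ ?_
  · simp only [Complex.neg_re, Complex.ofReal_re, Complex.add_re, Complex.mul_re, Complex.I_re,
      mul_zero, Complex.ofReal_im, Complex.I_im, mul_one, sub_self, add_zero, Complex.neg_im,
      neg_zero, Complex.add_im, Complex.mul_im, zero_add, Complex.ofReal_zero, zero_mul,
      smul_eq_mul] at rect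
    -- The point reflection about the centre `iδ` of the rectangle exchanges opposite sides, and `H`
    -- is odd under it. The boundary integral is therefore twice the contribution of the bottom and
    -- right sides.
    have e1 : ∫ x in (-R)..R, H (x + (2 * δ : ℝ) * Complex.I) = -∫ x in (-R)..R, H x := by
      rw [← intervalIntegral.integral_neg]
      have := intervalIntegral.integral_comp_neg (a := -R) (b := R)
        (fun x : ℝ => H (x + (2 * δ : ℝ) * Complex.I))
      rw [neg_neg] at this
      rw [← this]
      refine intervalIntegral.integral_congr fun x _ => ?_
      have := cothQuotient_reflect hδ hφ x
      refine Eq.trans ?_ this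
      change H _ = H _
      congr 1
      push_cast
      ring
    have e2 : ∫ y in (0 : ℝ)..(2 * δ), H (((-R : ℝ) : ℂ) + y * Complex.I) =
        -∫ y in (0 : ℝ)..(2 * δ), H (R + y * Complex.I) := by
      rw [← intervalIntegral.integral_neg]
      have := intervalIntegral.integral_comp_sub_left (a := 0) (b := 2 * δ)
        (fun y : ℝ => H (((-R : ℝ) : ℂ) + y * Complex.I)) (2 * δ)
      rw [sub_self, sub_zero] at this
      rw [← this]
      refine intervalIntegral.integral_congr fun y _ => ?_
      have := cothQuotient_reflect hδ hφ (R + y * Complex.I)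
      refine Eq.trans ?_ this
      change H _ = H _
      congr 1
      push_cast
      ring
    rw [e1, e2] at rect
    linear_combination (1 / 2 : ℂ) * rect
  · intro z hz
    refine (hcont z ?_ ?_).continuousWithinAt
    · have := hz.2
      simp [hδ.le] at this
      exact this.1
    · have := hz.2
      simp [hδ.le] at this
      exact this.2
  · intro z hz
    have h3 := hz.2
    simp [hδ.le] at h3
    refine (differentiableAt_cothQuotient (hd z h3.1.le h3.2.le) fun hs => ?_).differentiableWithinAt
    rcases sinh_eq_zero_of_strip hδ h3.1.le h3.2.le hs with rfl | rfl
    · simp at h3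
    · simp at h3

end

end INLS

/-! ### Passing to the limit in the contour integral -/

namespace INLS

noncomputable section

/-- Uniform exponential decay at both ends of the strip `0 ≤ Im z ≤ 2δ`. -/
def StripDecay (δ : ℝ) (F : ℂ → ℂ) : Prop :=
  ∃ C κ R₀ : ℝ, 0 < κ ∧ ∀ z : ℂ, 0 ≤ z.im → z.im ≤ 2 * δ → R₀ ≤ |z.re| →
    ‖F z‖ ≤ C * Real.exp (-κ * |z.re|)

lemma integrable_of_continuous_of_exp_decay {E : Type*} [NormedAddCommGroup E] {g : ℝ → E}
    (hg : Continuous g) {C κ R₀ : ℝ} (hκ : 0 < κ)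
    (h : ∀ x, R₀ ≤ |x| → ‖g x‖ ≤ C * Real.exp (-κ * |x|)) : Integrable g := by
  have hint : IntegrableOn (fun x : ℝ => Real.exp (-κ * x)) (Set.Ioi 0) :=
    exp_neg_integrableOn_Ioi 0 hκ
  have hint' : IntegrableOn (fun x : ℝ => Real.exp (κ * x)) (Set.Iio 0) := by
    have := integrableOn_exp_mul_Iic hκ 0
    exact this.mono_set Set.Iio_subset_Iic_self
  refine hg.locallyIntegrable.integrable_of_isBigO_atBot_atTop
    (g := fun x => Real.exp (κ * x)) ?_ ⟨Set.Iio 0, Iio_mem_atBot 0, hint'⟩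
    (g' := fun x => Real.exp (-κ * x)) ?_ ⟨Set.Ioi 0, Ioi_mem_atTop 0, hint⟩
  · refine Asymptotics.IsBigO.of_bound C ?_
    filter_upwards [eventually_le_atBot (-R₀), eventually_le_atBot 0] with x hx hx0
    have := h x (by rw [abs_of_nonpos hx0]; linarith)
    rwa [abs_of_nonpos hx0, neg_mul_neg, ← Real.norm_of_nonneg (Real.exp_pos (κ * x)).le] at this
  · refine Asymptotics.IsBigO.of_bound C ?_
    filter_upwards [eventually_ge_atTop R₀, eventually_ge_atTop 0] with x hx hx0
    have := h x (by rwa [abs_of_nonneg hx0])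
    rwa [abs_of_nonneg hx0, ← Real.norm_of_nonneg (Real.exp_pos (-κ * x)).le] at this

/-- This rests on `coth w - 1 = 2 / (e^{2w} - 1)`. -/
lemma norm_coth_sub_one_le {w : ℂ} (hw : 0 < w.re) :
    ‖Complex.cosh w / Complex.sinh w - 1‖ ≤ 2 / (Real.exp (2 * w.re) - 1) := by
  have h1 : 0 < Real.exp (2 * w.re) - 1 := by
    have := Real.add_one_lt_exp (show 2 * w.re ≠ 0 by positivity)
    linarith
  have h2 : Real.exp (2 * w.re) - 1 ≤ ‖Complex.exp (2 * w) - 1‖ := by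
    have := norm_sub_norm_le (Complex.exp (2 * w)) 1
    rw [Complex.norm_exp] at this
    simpa using this
  have hne : Complex.exp (2 * w) - 1 ≠ 0 := norm_pos_iff.1 (h1.trans_le h2)
  have hs : Complex.sinh w ≠ 0 := by
    intro hs
    apply hne
    have h3 : Complex.exp (2 * w) - 1 = 2 * Complex.exp w * Complex.sinh w := by
      rw [Complex.sinh, two_mul w, Complex.exp_add, Complex.exp_neg]
      have := Complex.exp_ne_zero w
      field_simp
    rw [h3, hs, mul_zero]
  have h4 : Complex.cosh w / Complex.sinh w - 1 = 2 / (Complex.exp (2 * w) - 1) := by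
    rw [div_sub_one hs, div_eq_div_iff hs hne, Complex.sinh, Complex.cosh, two_mul w,
      Complex.exp_add, Complex.exp_neg]
    have := Complex.exp_ne_zero w
    field_simp
    ring
  rw [h4, norm_div]
  simp only [Complex.norm_ofNat]
  gcongr

lemma abs_coth_le {η r : ℝ} (hη : 0 < η) (h : η ≤ |r|) :
    |Real.cosh r / Real.sinh r| ≤ 1 + 1 / Real.sinh η := by
  have h0 : 0 < |r| := hη.trans_le h
  have hs : 0 < Real.sinh η := Real.sinh_pos_iff.2 hη
  have hs' : Real.sinh η ≤ Real.sinh |r| := Real.sinh_le_sinh.2 h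
  have h1 : Real.cosh |r| ≤ Real.sinh |r| + 1 := by
    have := Real.cosh_sub_sinh |r|
    have h3 : Real.exp (-|r|) ≤ 1 := Real.exp_le_one_iff.2 (by linarith)
    linarith
  rw [abs_div, abs_of_pos (Real.cosh_pos r), Real.abs_sinh, ← Real.cosh_abs r]
  calc _ ≤ (Real.sinh |r| + 1) / Real.sinh |r| := by gcongr
    _ = 1 + 1 / Real.sinh |r| := by field_simp [(hs.trans_le hs').ne']
    _ ≤ _ := by gcongr

variable {δ : ℝ}

lemma cothQuotient_ofReal {c : ℝ} (hc : 0 < c) (φ : ℂ → ℂ) {r : ℝ} (hr : r ≠ 0) :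
    cothQuotient c φ r = φ r * ((Real.cosh (c * r) / Real.sinh (c * r) : ℝ) : ℂ) := by
  have : Real.sinh (c * r) ≠ 0 := by
    rw [Ne, Real.sinh_eq_zero]
    exact mul_ne_zero hc.ne' hr
  have h2 : Complex.sinh (c * r) ≠ 0 := by
    rw [← Complex.ofReal_mul, ← Complex.ofReal_sinh]
    exact_mod_cast this
  rw [cothQuotient, if_neg h2]
  push_cast
  rfl

/-- The improper integral that computes the transform of `F - F(· + 2iδ)` at the origin. -/
lemma integral_coth_odd_part (hδ : 0 < δ) {F : ℂ → ℂ}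
    (hd : ∀ z : ℂ, 0 ≤ z.im → z.im ≤ 2 * δ → DifferentiableAt ℂ F z) (hF : StripDecay δ F)
    {f : ℝ → ℝ} (hfint : Integrable f)
    (hf : ∀ r : ℝ, (f r : ℂ) = F r - F (r + 2 * δ * Complex.I)) :
    IntegrableOn (fun r : ℝ => Real.cosh (Real.pi / (2 * δ) * r) /
      Real.sinh (Real.pi / (2 * δ) * r) * (f r - f (-r))) (Set.Ioi 0) ∧
    ((∫ r in Set.Ioi 0, Real.cosh (Real.pi / (2 * δ) * r) /
      Real.sinh (Real.pi / (2 * δ) * r) * (f r - f (-r)) : ℝ) : ℂ) =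
        2 * δ * Complex.I * (F 0 + F (2 * δ * Complex.I)) := by
  set c := Real.pi / (2 * δ) with hcdef
  have hc : 0 < c := by positivity
  set α := F 0 + F (2 * δ * Complex.I) with hα
  -- Symmetrized so that `φ(2δi - z) = φ(z)`; the constant `α` is subtracted so that `φ` vanishes at
  -- the poles `0` and `2δi` of `coth`.
  set φ : ℂ → ℂ := fun z => F z + F (2 * δ * Complex.I - z) - α with hφdef
  have him : ∀ z : ℂ, (2 * δ * Complex.I - z).im = 2 * δ - z.im := fun z => by simp
  have hre : ∀ z : ℂ, (2 * δ * Complex.I - z).re = - z.re := fun z => by simp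
  have hφd : ∀ z : ℂ, 0 ≤ z.im → z.im ≤ 2 * δ → DifferentiableAt ℂ φ z := fun z h0 h1 => by
    have h2 : DifferentiableAt ℂ F (2 * δ * Complex.I - z) :=
      hd _ (by rw [him]; linarith) (by rw [him]; linarith)
    have h3 : DifferentiableAt ℂ (fun w => F (2 * δ * Complex.I - w)) z :=
      DifferentiableAt.comp z h2 (by fun_prop)
    exact ((hd z h0 h1).add h3).sub_const α
  have hφs : ∀ z, φ (2 * δ * Complex.I - z) = φ z := fun z => by
    simp only [hφdef, sub_sub_cancel]; ring
  have hφ0 : φ 0 = 0 := by simp [hφdef, hα]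
  set H := cothQuotient c φ with hH
  set h : ℝ → ℝ := fun r => Real.cosh (c * r) / Real.sinh (c * r) * (f r - f (-r)) with hh
  -- Folding the line at the origin removes the constant and leaves `φ(r) - φ(-r) = f(r) - f(-r)`,
  -- as `coth` is odd.
  have hHh : ∀ r : ℝ, r ≠ 0 → H r + H (-r : ℝ) = h r := by
    intro r hr
    rw [hH, cothQuotient_ofReal hc φ hr, cothQuotient_ofReal hc φ (neg_ne_zero.2 hr), mul_neg,
      Real.cosh_neg, Real.sinh_neg, div_neg, hh]
    push_cast
    rw [hf, show (f (-r) : ℂ) = F (-r : ℝ) - F ((-r : ℝ) + 2 * δ * Complex.I) from hf (-r)]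
    simp only [hφdef]
    push_cast
    have e1 : 2 * (δ : ℂ) * Complex.I - -r = r + 2 * δ * Complex.I := by ring
    have e2 : 2 * (δ : ℂ) * Complex.I - r = -r + 2 * δ * Complex.I := by ring
    rw [e1, e2]; ring
  have hHc : Continuous fun r : ℝ => H r := by
    refine continuous_iff_continuousAt.2 fun r => ?_
    have h1 : ContinuousAt H r := continuousAt_cothQuotient hc.ne'
      (hφd _ (by simp) (by simp [hδ.le])) fun hs => by
        rcases sinh_eq_zero_of_strip hδ (by simp) (by simp [hδ.le]) hs with h0 | h0
        · rw [h0, hφ0]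
        · have := congrArg Complex.im h0
          simp [hδ.ne'] at this
    exact ContinuousAt.comp (f := fun r : ℝ => (r : ℂ)) h1 Complex.continuous_ofReal.continuousAt
  have hHc' : Continuous fun r : ℝ => H r + H (-r : ℝ) := hHc.add (hHc.comp continuous_neg)
  have hint : IntegrableOn h (Set.Ioi 0) := by
    -- Near zero the integrand is the continuous function `H(r) + H(-r)`; beyond 1 the factor `coth`
    -- is bounded and `f` is integrable.
    rw [← Set.Ioc_union_Ioi_eq_Ioi zero_le_one]
    refine IntegrableOn.union ?_ ?_
    · have h1 : IntegrableOn (fun r : ℝ => (H r + H (-r : ℝ)).re) (Set.Ioc 0 1) :=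
        (Complex.continuous_re.comp hHc').integrableOn_Ioc
      refine h1.congr_fun (fun r hr => ?_) measurableSet_Ioc
      simp only
      rw [hHh r hr.1.ne', Complex.ofReal_re]
    · have hg : Integrable fun r => f r - f (-r) := hfint.sub hfint.comp_neg
      refine (hg.integrableOn (s := Set.Ioi 1)).bdd_mul (c := 1 + 1 / Real.sinh c) ?_ ?_
      · exact Measurable.aestronglyMeasurable (by fun_prop)
      · refine (ae_restrict_iff' measurableSet_Ioi).2 (Eventually.of_forall fun r hr => ?_)
        rw [Real.norm_eq_abs]
        refine abs_coth_le hc ?_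
        rw [abs_mul, abs_of_pos hc]
        have : (1 : ℝ) < |r| := lt_of_lt_of_le hr (le_abs_self r)
        nlinarith
  refine ⟨hint, ?_⟩
  have hlim := intervalIntegral_tendsto_integral_Ioi 0 hint tendsto_id
  have hlim' : Tendsto (fun R : ℝ => ((∫ r in (0 : ℝ)..R, h r : ℝ) : ℂ)) atTop
      (𝓝 ((∫ r in Set.Ioi 0, h r : ℝ) : ℂ)) :=
    (Complex.continuous_ofReal.tendsto _).comp hlim
  refine tendsto_nhds_unique hlim' ?_
  have hcontour : ∀ R : ℝ, 0 < R → ((∫ r in (0 : ℝ)..R, h r : ℝ) : ℂ) =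
      -Complex.I * ∫ y in (0 : ℝ)..(2 * δ), H (R + y * Complex.I) := by
    intro R hR
    rw [← integral_cothQuotient hδ hφd hφs hφ0 R]
    have e1 : ∫ x in (-R)..R, H x = (∫ x in (-R)..0, H x) + ∫ x in (0 : ℝ)..R, H x :=
      (intervalIntegral.integral_add_adjacent_intervals (hHc.intervalIntegrable _ _)
        (hHc.intervalIntegrable _ _)).symm
    have e2 : ∫ x in (-R)..0, H x = ∫ x in (0 : ℝ)..R, H (-x : ℝ) := by
      have := intervalIntegral.integral_comp_neg (a := 0) (b := R) (fun x : ℝ => H x)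
      rw [neg_zero] at this
      exact this.symm
    have hHn : Continuous fun r : ℝ => H (-r : ℝ) := hHc.comp continuous_neg
    rw [← hH, e1, e2, ← intervalIntegral.integral_add
      (hHn.intervalIntegrable _ _) (hHc.intervalIntegrable _ _),
      ← intervalIntegral.integral_ofReal]
    refine intervalIntegral.integral_congr_ae (Eventually.of_forall fun r hr => ?_)
    rw [Set.uIoc_of_le hR.le] at hr
    rw [← hHh r hr.1.ne', add_comm]
  obtain ⟨C, κ, R₀, hκ, hdec⟩ := hF
  set d : ℝ → ℝ := fun R => 2 / (Real.exp (2 * (c * R)) - 1) with hdd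
  have hd0 : Tendsto d atTop (𝓝 0) := by
    refine Tendsto.div_atTop tendsto_const_nhds (tendsto_atTop_add_const_right _ (-1) ?_)
    refine Real.tendsto_exp_atTop.comp ?_
    exact (tendsto_id.const_mul_atTop hc).const_mul_atTop two_pos
  have he0 : Tendsto (fun R : ℝ => C * Real.exp (-κ * R)) atTop (𝓝 0) := by
    have : Tendsto (fun R : ℝ => -κ * R) atTop atBot :=
      tendsto_id.const_mul_atTop_of_neg (neg_lt_zero.2 hκ)
    simpa using (Real.tendsto_exp_atBot.comp this).const_mul C
  -- On the right edge `F` and its reflection decay and `coth → 1`, so `H → -α` uniformly along a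
  -- segment of length `2δ`. The subtracted constant is thus the source of the value of the
  -- transform.
  have hedge : Tendsto (fun R : ℝ => ∫ y in (0 : ℝ)..(2 * δ), H (R + y * Complex.I)) atTop
      (𝓝 (-(2 * δ * α))) := by
    rw [tendsto_iff_norm_sub_tendsto_zero]
    have hb : Tendsto (fun R : ℝ => (2 * (C * Real.exp (-κ * R)) * (1 + d R) + ‖α‖ * d R) *
        |2 * δ - 0|) atTop (𝓝 0) := by
      have := (((he0.const_mul 2).mul (hd0.const_add 1)).add (hd0.const_mul ‖α‖)).mul_const
        |2 * δ - 0|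
      simpa using this
    refine squeeze_zero' (Eventually.of_forall fun _ => norm_nonneg _) ?_ hb
    filter_upwards [eventually_gt_atTop 0, eventually_ge_atTop R₀] with R hR hR0
    have hcontR : Continuous fun y : ℝ => (R : ℂ) + y * Complex.I := by fun_prop
    have hpt : ∀ y : ℝ, 0 ≤ y → y ≤ 2 * δ →
        ‖H (R + y * Complex.I) + α‖ ≤ 2 * (C * Real.exp (-κ * R)) * (1 + d R) + ‖α‖ * d R := by
      intro y hy0 hy1
      set z : ℂ := R + y * Complex.I with hz
      have hzre : z.re = R := by simp [hz]
      have hzim : z.im = y := by simp [hz]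
      have hs : Complex.sinh (c * z) ≠ 0 := fun hs => by
        rcases sinh_eq_zero_of_strip hδ (by rw [hzim]; exact hy0) (by rw [hzim]; exact hy1) hs
          with h0 | h0
        · rw [h0] at hzre; simp at hzre; linarith
        · rw [h0] at hzre; simp at hzre; linarith
      have hq := norm_coth_sub_one_le (w := c * z) (by simp [hzre]; positivity)
      have hcre : ((c : ℂ) * z).re = c * R := by simp [hzre]
      rw [hcre] at hq
      change _ ≤ d R at hq
      have hF1 := hdec z (by rw [hzim]; exact hy0) (by rw [hzim]; exact hy1)
        (by rw [hzre, abs_of_pos hR]; exact hR0)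
      have hF2 := hdec (2 * δ * Complex.I - z) (by rw [him, hzim]; linarith)
        (by rw [him, hzim]; linarith) (by rw [hre, hzre, abs_neg, abs_of_pos hR]; exact hR0)
      rw [hzre, abs_of_pos hR] at hF1
      rw [hre, hzre, abs_neg, abs_of_pos hR] at hF2
      have e : H z + α = (F z + F (2 * δ * Complex.I - z)) *
          (1 + (Complex.cosh (c * z) / Complex.sinh (c * z) - 1)) -
          α * (Complex.cosh (c * z) / Complex.sinh (c * z) - 1) := by
        rw [hH, cothQuotient, if_neg hs, hφdef]
        ring
      rw [e]
      generalize Complex.cosh (c * z) / Complex.sinh (c * z) - 1 = q at *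
      have b1 : ‖F z + F (2 * δ * Complex.I - z)‖ ≤ 2 * (C * Real.exp (-κ * R)) :=
        (norm_add_le _ _).trans (by linarith)
      have b2 : ‖1 + q‖ ≤ 1 + d R := (norm_add_le _ _).trans (by rw [norm_one]; linarith)
      refine (norm_sub_le _ _).trans (add_le_add ?_ ?_)
      · rw [norm_mul]
        exact mul_le_mul b1 b2 (norm_nonneg _) ((norm_nonneg _).trans b1)
      · rw [norm_mul]
        exact mul_le_mul_of_nonneg_left hq (norm_nonneg _)
    have hHint : IntervalIntegrable (fun y : ℝ => H (R + y * Complex.I)) volume 0 (2 * δ) := by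
      refine ContinuousOn.intervalIntegrable fun y hy => ?_
      rw [Set.uIcc_of_le (by linarith)] at hy
      have h1 : ContinuousAt H (R + y * Complex.I) := by
        refine (differentiableAt_cothQuotient (hφd _ (by simpa using hy.1) (by simpa using hy.2))
          fun hs => ?_).continuousAt
        rcases sinh_eq_zero_of_strip hδ (by simpa using hy.1) (by simpa using hy.2) hs with h0 | h0
        · have := congrArg Complex.re h0; simp at this; linarith
        · have := congrArg Complex.re h0; simp at this; linarith
      exact (ContinuousAt.comp (f := fun y : ℝ => (R : ℂ) + y * Complex.I) h1
        hcontR.continuousAt).continuousWithinAt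
    have e3 : (∫ y in (0 : ℝ)..(2 * δ), H (R + y * Complex.I)) - -(2 * δ * α) =
        ∫ y in (0 : ℝ)..(2 * δ), (H (R + y * Complex.I) + α) := by
      rw [intervalIntegral.integral_add hHint (by simp), intervalIntegral.integral_const]
      simp
    rw [e3]
    refine intervalIntegral.norm_integral_le_of_norm_le_const fun y hy => ?_
    rw [Set.uIoc_of_le (by linarith)] at hy
    exact hpt y hy.1.le hy.2
  have hfin := hedge.const_mul (-Complex.I)
  have e4 : -Complex.I * -(2 * δ * α) = 2 * δ * Complex.I * α := by ring
  rw [e4] at hfin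
  refine hfin.congr' ?_
  filter_upwards [eventually_gt_atTop 0] with R hR
  exact (hcontour R hR).symm

end

end INLS

/-! ### The principal value transform `T` -/

namespace INLS

noncomputable section

variable {δ : ℝ}

/-- Folding the two half-lines together turns the principal value into an ordinary improper integral
of the odd part of `f` against `coth`. -/
lemma setIntegral_abs_gt (g : ℝ → ℝ) {η : ℝ} (hη : 0 < η)
    (hg : IntegrableOn g {r | η < |r|}) :
    ∫ r in {r | η < |r|}, g r = ∫ r in Set.Ioi η, (g r + g (-r)) := by
  have hset : {r : ℝ | η < |r|} = Set.Ioi η ∪ Set.Iic (-η) \ {-η} := by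
    ext r
    simp only [Set.mem_ofPred_eq, lt_abs, Set.mem_union, Set.mem_Ioi, Set.mem_sdiff, Set.mem_Iic,
      Set.mem_singleton_iff]
    constructor
    · rintro (h | h)
      · exact Or.inl h
      · exact Or.inr ⟨by linarith, by intro h'; linarith⟩
    · rintro (h | ⟨h, h'⟩)
      · exact Or.inl h
      · right
        have := lt_of_le_of_ne h h'
        linarith
  have hae : (Set.Iic (-η) \ {-η} : Set ℝ) =ᵐ[volume] Set.Iic (-η) :=
    sdiff_null_ae_eq_self (measure_singleton _)
  have h1 : IntegrableOn g (Set.Ioi η) := hg.mono_set fun r hr => hr.trans_le (le_abs_self r)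
  have h2 : IntegrableOn g (Set.Iic (-η) \ {-η}) := hg.mono_set (by
    rw [hset]; exact Set.subset_union_right)
  have h3 : IntegrableOn g (Set.Iic (-η)) := h2.congr_set_ae hae.symm
  have h4 : IntegrableOn (fun r => g (-r)) (Set.Ioi η) := by
    have := (integrableOn_Iic_iff_integrableOn_Iio (f := g) (b := -η)).1 h3
    exact this.comp_neg_Ioi
  rw [hset, setIntegral_union _ (measurableSet_Iic.diff (measurableSet_singleton _)) h1 h2,
    setIntegral_congr_set hae, integral_add h1 h4, integral_comp_neg_Ioi]
  rw [Set.disjoint_left]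
  rintro r hr ⟨hr', -⟩
  simp only [Set.mem_Ioi, Set.mem_Iic] at hr hr'
  linarith

lemma integrableOn_cothIntegrand (hδ : 0 < δ) {f : ℝ → ℝ} (hf : Integrable f) (x : ℝ) {η : ℝ}
    (hη : 0 < η) : IntegrableOn (cothIntegrand δ f x) {y | η < |y - x|} := by
  have hc : 0 < Real.pi / (2 * δ) := by positivity
  have hmeas : MeasurableSet {y : ℝ | η < |y - x|} :=
    measurableSet_lt measurable_const (by fun_prop)
  refine Integrable.bdd_mul (c := |1 / (2 * δ)| * (1 + 1 / Real.sinh (Real.pi / (2 * δ) * η)))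
    hf.integrableOn ?_ ?_
  · exact Measurable.aestronglyMeasurable (by fun_prop)
  · refine (ae_restrict_iff' hmeas).2 (Eventually.of_forall fun r hr => ?_)
    rw [Real.norm_eq_abs, abs_mul]
    refine mul_le_mul_of_nonneg_left (abs_coth_le (by positivity) ?_) (abs_nonneg _)
    rw [abs_mul, abs_of_pos hc]
    exact mul_le_mul_of_nonneg_left (le_of_lt hr) hc.le

/-- The transform `T` of `F - F(· + 2iδ)` is `i (F + F(· + 2iδ))` when `F` is holomorphic in the
closed strip and decays at its ends. -/
lemma exists_hasT (hδ : 0 < δ) {F : ℂ → ℂ}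
    (hd : ∀ z : ℂ, 0 ≤ z.im → z.im ≤ 2 * δ → DifferentiableAt ℂ F z) (hF : StripDecay δ F)
    {f : ℝ → ℝ} (hf : ∀ r : ℝ, (f r : ℂ) = F r - F (r + 2 * δ * Complex.I)) (x : ℝ) :
    ∃ l : ℝ, HasT δ f x l ∧ (l : ℂ) = Complex.I * (F x + F (x + 2 * δ * Complex.I)) := by
  have hfint : Integrable f := by
    have hcont : Continuous fun r : ℝ => F r - F (r + 2 * δ * Complex.I) := by
      refine continuous_iff_continuousAt.2 fun r => ContinuousAt.sub ?_ ?_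
      · exact ContinuousAt.comp (f := fun r : ℝ => (r : ℂ))
          (hd r (by simp) (by simp [hδ.le])).continuousAt Complex.continuous_ofReal.continuousAt
      · exact ContinuousAt.comp (f := fun r : ℝ => (r : ℂ) + 2 * δ * Complex.I)
          (hd _ (by simp [hδ.le]) (by simp)).continuousAt (by fun_prop)
    have hfc : Continuous f := by
      have : f = fun r : ℝ => (F r - F (r + 2 * δ * Complex.I)).re := by
        ext r; rw [← hf, Complex.ofReal_re]
      rw [this]
      exact Complex.continuous_re.comp hcont
    obtain ⟨C, κ, R₀, hκ, hdec⟩ := hF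
    refine integrable_of_continuous_of_exp_decay hfc (C := 2 * C) (R₀ := R₀) hκ fun r hr => ?_
    have h1 := hdec r (by simp) (by simp [hδ.le]) (by simpa using hr)
    have h2 := hdec (r + 2 * δ * Complex.I) (by simp [hδ.le]) (by simp) (by simpa using hr)
    rw [← Complex.norm_real, hf]
    refine (norm_sub_le _ _).trans ?_
    simp only [Complex.ofReal_re] at h1
    have h3 : ((r : ℂ) + 2 * δ * Complex.I).re = r := by simp
    rw [h3] at h2
    linarith
  -- Real translation reduces the transform at `x` to the one at the origin; the decay constant
  -- grows by the factor `e^{κ|x|}`.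
  have hF' : StripDecay δ fun z => F (x + z) := by
    obtain ⟨C, κ, R₀, hκ, hdec⟩ := hF
    refine ⟨|C| * Real.exp (κ * |x|), κ, R₀ + |x|, hκ, fun z h0 h1 hR => ?_⟩
    have habs : |z.re| - |x| ≤ |x + z.re| := by
      have := abs_sub_abs_le_abs_sub z.re (-x)
      rw [abs_neg, sub_neg_eq_add, add_comm z.re] at this
      exact this
    have h2 := hdec (x + z) (by simpa using h0) (by simpa using h1)
      (by simp only [Complex.add_re, Complex.ofReal_re]; linarith)
    refine h2.trans ?_
    simp only [Complex.add_re, Complex.ofReal_re]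
    rw [mul_assoc, ← Real.exp_add]
    refine mul_le_mul (le_abs_self C) (Real.exp_le_exp.2 ?_) (Real.exp_pos _).le (abs_nonneg _)
    nlinarith
  obtain ⟨hint, hval⟩ := integral_coth_odd_part hδ (F := fun z => F (x + z))
    (fun z h0 h1 => by
      have := hd (x + z) (by simpa using h0) (by simpa using h1)
      exact DifferentiableAt.comp z this (by fun_prop)) hF'
    (f := fun r => f (x + r)) (hfint.comp_add_left x) (fun r => by
      rw [hf]; push_cast; rw [add_assoc])
  set h : ℝ → ℝ := fun r => Real.cosh (Real.pi / (2 * δ) * r) /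
      Real.sinh (Real.pi / (2 * δ) * r) * (f (x + r) - f (x + -r)) with hh
  refine ⟨1 / (2 * δ) * ∫ r in Set.Ioi 0, h r,
    ⟨fun η hη => integrableOn_cothIntegrand hδ hfint x hη, ?_⟩, ?_⟩
  · have hstep : ∀ η : ℝ, 0 < η → ∫ y in {y | η < |y - x|}, cothIntegrand δ f x y =
        1 / (2 * δ) * ∫ r in Set.Ioi η, h r := by
      intro η hη
      have hi := integrableOn_cothIntegrand hδ hfint x hη
      have hmeas : MeasurableSet {y : ℝ | η < |y - x|} :=
        measurableSet_lt measurable_const (by fun_prop)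
      have hmeas' : MeasurableSet {y : ℝ | η < |y|} :=
        measurableSet_lt measurable_const (by fun_prop)
      have hind : ∀ r : ℝ, Set.indicator {y : ℝ | η < |y - x|} (cothIntegrand δ f x) (x + r) =
          Set.indicator {y : ℝ | η < |y|} (fun r => cothIntegrand δ f x (x + r)) r := by
        intro r
        simp only [Set.indicator, Set.mem_ofPred_eq, add_sub_cancel_left]
      have hi' : IntegrableOn (fun r => cothIntegrand δ f x (x + r)) {y : ℝ | η < |y|} := by
        rw [← integrable_indicator_iff hmeas] at hi
        rw [← integrable_indicator_iff hmeas']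
        have := hi.comp_add_left x
        simpa only [hind] using this
      rw [← integral_indicator hmeas, ← integral_add_left_eq_self _ x]
      simp only [hind]
      rw [integral_indicator hmeas', setIntegral_abs_gt _ hη hi', ← integral_const_mul]
      refine integral_congr_ae (Eventually.of_forall fun r => ?_)
      simp only [cothIntegrand, hh, add_sub_cancel_left, mul_neg, Real.cosh_neg, Real.sinh_neg,
        div_neg]
      ring
    -- The folded integrand is integrable up to zero, so the truncations converge without further
    -- cancellation.
    have hlim : Tendsto (fun η : ℝ => ∫ r in Set.Ioi η, h r) (𝓝[>] 0)
        (𝓝 (∫ r in Set.Ioi 0, h r)) := by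
      have hcov : AECover (volume.restrict (Set.Ioi (0 : ℝ))) (𝓝[>] (0 : ℝ))
          (fun η : ℝ => Set.Ioi η) :=
        aecover_Ioi_of_Ioi (tendsto_id.mono_left nhdsWithin_le_nhds)
      have := hcov.integral_tendsto_of_countably_generated hint
      refine this.congr' ?_
      filter_upwards [self_mem_nhdsWithin] with η hη
      rw [Measure.restrict_restrict measurableSet_Ioi, Set.Ioi_inter_Ioi,
        sup_eq_left.2 (le_of_lt hη)]
    refine (hlim.const_mul (1 / (2 * δ))).congr' ?_
    filter_upwards [self_mem_nhdsWithin] with η hη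
    exact (hstep η hη).symm
  · rw [Complex.ofReal_mul, hval]
    have : (δ : ℂ) ≠ 0 := by exact_mod_cast hδ.ne'
    push_cast
    rw [add_zero]
    field_simp

end

end INLS

/-! ### Exponential decay at both ends of the strip -/

namespace INLS

noncomputable section

open Polynomial Matrix

variable {n : ℕ}

lemma MirrorData.c_ne_zero {K Λ c : Fin (n + n) → ℂ} (h : MirrorData K Λ c) (j : Fin (n + n)) :
    c j ≠ 0 := by
  intro hc
  have hw := h.weight j
  rw [hc, zero_mul, Finset.prod_div_distrib] at hw
  exact neg_ne_zero.2 (div_ne_zero (prod_erase_sub_ne_zero h.Λ_inj j)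
    (prod_erase_sub_ne_zero h.K_inj j)) hw.symm

/-- Weights of the first block after rescaling the rows in `S`. -/
def scaledLeft (S : Finset (Fin (n + n))) (c r : Fin (n + n) → ℂ) (j : Fin (n + n)) : ℂ :=
  if j ∈ S then c j else c j * r j

/-- Weights of the second block after rescaling the rows in `S`. -/
def scaledRight (S : Finset (Fin (n + n))) (r : Fin (n + n) → ℂ) (j : Fin (n + n)) : ℂ :=
  if j ∈ S then r j else 1

section Scaled

variable {K Λ c : Fin (n + n) → ℂ} {S : Finset (Fin (n + n))}

lemma eq_zero_of_eval_mem (hK : Function.Injective K) (hS : S.card = n) {A : ℂ[X]}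
    (hA : A.degree < n) (h : ∀ j ∈ S, A.eval (K j) = 0) : A = 0 :=
  Polynomial.eq_zero_of_degree_lt_of_eval_index_eq_zero (s := S) (v := K)
    (fun _ _ _ _ hab => hK hab) (by rwa [hS]) h

/-- At `r = 0` the rows in `S` constrain only `A` and the other rows only `B`. Each polynomial has
degree below `n` and vanishes at `n` distinct nodes. -/
lemma det_scaled_zero_ne_zero (h : MirrorData K Λ c) (hS : S.card = n) :
    (pairMatrix n K Λ (scaledLeft S c 0) (scaledRight S 0)).det ≠ 0 := by
  rw [det_pairMatrix_ne_zero_iff]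
  intro A B hA hB hAB
  constructor
  · refine eq_zero_of_eval_mem h.K_inj hS hA fun j hj => ?_
    have := hAB j
    simpa [scaledLeft, scaledRight, hj, h.c_ne_zero j] using this
  · refine eq_zero_of_eval_mem h.Λ_inj (S := Sᶜ) ?_ hB fun j hj => ?_
    · rw [Finset.card_compl, hS, Fintype.card_fin]; omega
    · have := hAB j
      have hj' : j ∉ S := by simpa using hj
      simpa [scaledLeft, scaledRight, hj'] using this

lemma coeffQ_scaled_zero (h : MirrorData K Λ c) (hS : S.card = n) (q : Fin n) :
    coeffQ K Λ (scaledLeft S c 0) (scaledRight S 0) (Fin.castAdd n q) = 0 := by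
  have hA : (ofCoeffs fun q => coeffQ K Λ (scaledLeft S c 0) (scaledRight S 0)
      (Fin.castAdd n q)) = 0 := by
    refine eq_zero_of_eval_mem h.K_inj hS (degree_ofCoeffs_lt _) fun j hj => ?_
    have := coeffQ_spec (det_scaled_zero_ne_zero h hS) j
    simpa [scaledLeft, scaledRight, hj, h.c_ne_zero j] using this
  rw [← coeff_ofCoeffs (fun q => coeffQ K Λ (scaledLeft S c 0) (scaledRight S 0)
      (Fin.castAdd n q)) q, hA, coeff_zero]

lemma contDiff_scaledLeft (S : Finset (Fin (n + n))) (c : Fin (n + n) → ℂ) (j : Fin (n + n)) :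
    ContDiff ℂ 1 fun r => scaledLeft S c r j := by
  unfold scaledLeft
  split_ifs <;> fun_prop

lemma contDiff_scaledRight (S : Finset (Fin (n + n))) (j : Fin (n + n)) :
    ContDiff ℂ 1 fun r => scaledRight S r j := by
  unfold scaledRight
  split_ifs <;> fun_prop

/-- The decoupled limit `r = 0` is regular, so the coefficients are `C¹` near it. Those of the first
`coeffQ` member vanish in the limit and are therefore `O(‖r‖)`; those of `coeffP` need not vanish
there, so only their derivative is bounded. -/
lemma exists_scaled_bounds (h : MirrorData K Λ c) (hS : S.card = n) (q : Fin n) :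
    ∃ C ρ : ℝ, 0 < ρ ∧ ∀ r : Fin (n + n) → ℂ, ‖r‖ < ρ →
      (pairMatrix n K Λ (scaledLeft S c r) (scaledRight S r)).det ≠ 0 ∧
      ‖coeffQ K Λ (scaledLeft S c r) (scaledRight S r) (Fin.castAdd n q)‖ ≤ C * ‖r‖ ∧
      DifferentiableAt ℂ
        (fun r => coeffP K Λ (scaledLeft S c r) (scaledRight S r) (Fin.castAdd n q)) r ∧
      ‖fderiv ℂ (fun r => coeffP K Λ (scaledLeft S c r) (scaledRight S r)
        (Fin.castAdd n q)) r‖ ≤ C := by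
  have hdet := det_scaled_zero_ne_zero h hS
  have hE := fun j => (contDiff_scaledLeft S c j).contDiffAt (x := 0)
  have hF := fun j => (contDiff_scaledRight S j).contDiffAt (x := 0)
  have hQ := contDiffAt_coeffQ (K := K) (Λ := Λ) hE hF hdet (Fin.castAdd n q)
  have hP := contDiffAt_coeffP (K := K) (Λ := Λ) hE hF hdet (Fin.castAdd n q)
  have h1 : ∀ᶠ r in 𝓝 (0 : Fin (n + n) → ℂ),
      (pairMatrix n K Λ (scaledLeft S c r) (scaledRight S r)).det ≠ 0 :=
    (contDiffAt_det (contDiffAt_pairMatrix n hE hF)).continuousAt.eventually_ne hdet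
  obtain ⟨C₁, hC₁⟩ := (hQ.differentiableAt one_ne_zero).isBigO_sub.bound
  have h3 : ∀ᶠ r in 𝓝 (0 : Fin (n + n) → ℂ), DifferentiableAt ℂ
        (fun r => coeffP K Λ (scaledLeft S c r) (scaledRight S r) (Fin.castAdd n q)) r := by
    filter_upwards [h1] with r hr
    exact (contDiffAt_coeffP (fun j => (contDiff_scaledLeft S c j).contDiffAt)
      (fun j => (contDiff_scaledRight S j).contDiffAt) hr _).differentiableAt one_ne_zero
  have h4 := (hP.continuousAt_fderiv one_ne_zero).norm.eventually_lt_const (lt_add_one _)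
  obtain ⟨ρ, hρ, hball⟩ := Metric.eventually_nhds_iff.1 ((h1.and hC₁).and (h3.and h4))
  refine ⟨max C₁ (‖fderiv ℂ (fun r => coeffP K Λ (scaledLeft S c r) (scaledRight S r)
        (Fin.castAdd n q)) 0‖ + 1), ρ, hρ, fun r hr => ?_⟩
  obtain ⟨⟨b1, b2⟩, b3, b4⟩ := hball (y := r) (by simpa using hr)
  refine ⟨b1, ?_, b3, b4.le.trans (le_max_right _ _)⟩
  rw [coeffQ_scaled_zero h hS, sub_zero, sub_zero] at b2
  exact b2.trans (mul_le_mul_of_nonneg_right (le_max_left _ _) (norm_nonneg _))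

end Scaled

variable {δ ξ : ℝ} {k a c : Fin (n + n) → ℂ} {Λ : Fin (n + n) → ℂ}

/-- The decaying exponentials `e^{∓λ_j}`: the sign is `-` for the rows in `S`. -/
def decayFactor (S : Finset (Fin (n + n))) (δ ξ : ℝ) (k a : Fin (n + n) → ℂ) (t : ℝ) (z : ℂ)
    (j : Fin (n + n)) : ℂ :=
  Complex.exp ((if j ∈ S then -1 else 1) * phase δ ξ (k j) (a j) z t)

lemma expFactor_eq_scaled (S : Finset (Fin (n + n))) (t : ℝ) (z : ℂ) :
    ∃ s : Fin (n + n) → ℂ, (∀ j, s j ≠ 0) ∧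
      expFactor δ ξ k a c z t = s * scaledLeft S c (decayFactor S δ ξ k a t z) ∧
      1 = s * scaledRight S (decayFactor S δ ξ k a t z) := by
  refine ⟨fun j => if j ∈ S then Complex.exp (phase δ ξ (k j) (a j) z t) else 1, fun j => ?_,
    ?_, ?_⟩
  · simp only; split_ifs
    · exact Complex.exp_ne_zero _
    · exact one_ne_zero
  · ext j
    simp only [expFactor, Pi.mul_apply, scaledLeft, decayFactor]
    split_ifs <;> simp [mul_comm]
  · ext j
    simp only [Pi.mul_apply, scaledRight, decayFactor, Pi.one_apply]
    split_ifs <;> simp [← Complex.exp_add]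

lemma coeff_eq_scaled (S : Finset (Fin (n + n))) (t : ℝ) (z : ℂ) :
    coeffP k Λ (expFactor δ ξ k a c z t) 1 = coeffP k Λ
      (scaledLeft S c (decayFactor S δ ξ k a t z)) (scaledRight S (decayFactor S δ ξ k a t z)) ∧
    coeffQ k Λ (expFactor δ ξ k a c z t) 1 = coeffQ k Λ
      (scaledLeft S c (decayFactor S δ ξ k a t z)) (scaledRight S (decayFactor S δ ξ k a t z)) ∧
    ((pairMatrix n k Λ (scaledLeft S c (decayFactor S δ ξ k a t z))
      (scaledRight S (decayFactor S δ ξ k a t z))).det ≠ 0 →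
        (pairMatrix n k Λ (expFactor δ ξ k a c z t) 1).det ≠ 0) := by
  obtain ⟨s, hs, h1, h2⟩ := expFactor_eq_scaled (δ := δ) (ξ := ξ) (k := k) (a := a) (c := c) S t z
  rw [h1, h2]
  exact ⟨(coeff_smul _ _ _ _ s hs).1, (coeff_smul _ _ _ _ s hs).2,
    (det_pairMatrix_smul_ne_zero_iff n _ _ _ _ s hs).2⟩

lemma hasDerivAt_decayFactor (S : Finset (Fin (n + n))) (t : ℝ) (z : ℂ) :
    HasDerivAt (decayFactor S δ ξ k a t)
      (fun j => (if j ∈ S then -1 else 1) * k j * decayFactor S δ ξ k a t z j) z := by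
  rw [hasDerivAt_pi]
  intro j
  have h : HasDerivAt (fun y => phase δ ξ (k j) (a j) y t) (k j) z := by
    have := ((((hasDerivAt_id z).const_mul (k j)).const_add ((k j - bigL δ (k j)) * ξ)).add_const
      (Complex.I * k j ^ 2 * t)).add_const (a j)
    simpa [phase] using this
  have := (h.const_mul (if j ∈ S then (-1 : ℂ) else 1)).cexp
  refine this.congr_deriv ?_
  rw [decayFactor]; ring

/-- The rate is the smallest `|Re k_j|`. The bounded imaginary part of `z` and the constant part of
the phase only affect the prefactor. -/
lemma norm_decayFactor_le [NeZero n] {S : Finset (Fin (n + n))} {s : ℝ}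
    (hs : s = 1 ∨ s = -1) (hsign : ∀ j, s * ((if j ∈ S then -1 else 1) * (k j).re) < 0) (t : ℝ) :
    ∃ D κ : ℝ, 0 < D ∧ 0 < κ ∧ ∀ z : ℂ, |z.im| ≤ δ → 0 ≤ s * z.re →
      ‖decayFactor S δ ξ k a t z‖ ≤ D * Real.exp (-κ * |z.re|) := by
  set b : Fin (n + n) → ℂ := fun j => (k j - bigL δ (k j)) * ξ + Complex.I * k j ^ 2 * t + a j
    with hb
  obtain ⟨j₀, hj₀⟩ := Finite.exists_min
    fun j => -(s * ((if j ∈ S then -1 else 1) * (k j).re))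
  refine ⟨∑ j, Real.exp (‖b j‖ + |(k j).im| * δ), _, ?_, neg_pos.2 (hsign j₀), fun z hz hsz => ?_⟩
  · exact Finset.sum_pos (fun _ _ => Real.exp_pos _) ⟨j₀, Finset.mem_univ _⟩
  refine (pi_norm_le_iff_of_nonneg (by positivity)).2 fun j => ?_
  refine le_trans ?_ (mul_le_mul_of_nonneg_right (Finset.single_le_sum
    (f := fun j => Real.exp (‖b j‖ + |(k j).im| * δ)) (fun _ _ => (Real.exp_pos _).le)
    (Finset.mem_univ j)) (Real.exp_pos _).le)
  rw [decayFactor, Complex.norm_exp, ← Real.exp_add]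
  refine Real.exp_le_exp.2 ?_
  have habs : |z.re| = s * z.re := by
    rcases hs with rfl | rfl
    · rw [one_mul] at hsz ⊢; exact abs_of_nonneg hsz
    · have : z.re ≤ 0 := by linarith
      rw [abs_of_nonpos this]; ring
  have hs2 : s * s = 1 := by rcases hs with rfl | rfl <;> norm_num
  have hphase : phase δ ξ (k j) (a j) z t = b j + k j * z := by
    rw [phase, hb]; ring
  have h1 := hj₀ j
  have h2 := (abs_le.1 (Complex.abs_re_le_norm (b j)))
  have h3 : |(k j).im * z.im| ≤ |(k j).im| * δ := by
    rw [abs_mul]; exact mul_le_mul_of_nonneg_left hz (abs_nonneg _)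
  have h4 := abs_le.1 h3
  have h5 := mul_le_mul_of_nonneg_right h1 hsz
  rw [hphase, habs, neg_neg]
  by_cases hj : j ∈ S
  · simp only [hj, if_true, neg_one_mul, Complex.neg_re, Complex.add_re, Complex.mul_re] at h5 ⊢
    have h6 : -(s * -(k j).re) * (s * z.re) = (k j).re * z.re := by
      linear_combination ((k j).re * z.re) * hs2
    rw [h6] at h5
    linarith
  · simp only [hj, if_false, one_mul, Complex.add_re, Complex.mul_re] at h5 ⊢
    have h6 : -(s * (k j).re) * (s * z.re) = -((k j).re * z.re) := by
      linear_combination (-((k j).re * z.re)) * hs2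
    rw [h6] at h5
    linarith

/-- Decay at one end of the strip. -/
lemma exists_one_sided_decay [NeZero n] (h : MirrorData k Λ c) {S : Finset (Fin (n + n))}
    (hS : S.card = n) {s : ℝ} (hs : s = 1 ∨ s = -1)
    (hsign : ∀ j, s * ((if j ∈ S then -1 else 1) * (k j).re) < 0) (t : ℝ) (q : Fin n) :
    ∃ C κ R₀ : ℝ, 0 ≤ C ∧ 0 < κ ∧ ∀ z : ℂ, |z.im| ≤ δ → 0 ≤ s * z.re → R₀ ≤ |z.re| →
      (pairMatrix n k Λ (expFactor δ ξ k a c z t) 1).det ≠ 0 ∧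
      ‖coeffQ k Λ (expFactor δ ξ k a c z t) 1 (Fin.castAdd n q)‖ ≤ C * Real.exp (-κ * |z.re|) ∧
      ‖deriv (fun y => coeffP k Λ (expFactor δ ξ k a c y t) 1 (Fin.castAdd n q)) z‖ ≤
        C * Real.exp (-κ * |z.re|) := by
  obtain ⟨C, ρ, hρ, hbound⟩ := exists_scaled_bounds h hS q
  obtain ⟨D, κ, hD, hκ, hdecay⟩ := norm_decayFactor_le (δ := δ) (ξ := ξ) (a := a) hs hsign t
  have hlim : Tendsto (fun x : ℝ => D * Real.exp (-κ * x)) atTop (𝓝 0) := by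
    have : Tendsto (fun R : ℝ => -κ * R) atTop atBot :=
      tendsto_id.const_mul_atTop_of_neg (neg_lt_zero.2 hκ)
    simpa using (Real.tendsto_exp_atBot.comp this).const_mul D
  obtain ⟨R₀, hR₀⟩ := eventually_atTop.1 (hlim.eventually_lt_const hρ)
  refine ⟨|C| * D + |C| * (‖k‖ * D), κ, R₀, by positivity, hκ, fun z hz hsz hR => ?_⟩
  have hr := hdecay z hz hsz
  obtain ⟨b1, b2, b3, b4⟩ := hbound _ (hr.trans_lt (hR₀ _ hR))
  obtain ⟨-, e2, e3⟩ := coeff_eq_scaled (δ := δ) (ξ := ξ) (k := k) (a := a) (c := c) (Λ := Λ) S t z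
  refine ⟨e3 b1, ?_, ?_⟩
  · rw [e2]
    refine b2.trans ?_
    calc C * ‖decayFactor S δ ξ k a t z‖ ≤ |C| * (D * Real.exp (-κ * |z.re|)) :=
          mul_le_mul (le_abs_self C) hr (norm_nonneg _) (abs_nonneg _)
      _ ≤ _ := by
          rw [add_mul, ← mul_assoc]
          exact le_add_of_nonneg_right (by positivity)
  · have hcomp : (fun y => coeffP k Λ (expFactor δ ξ k a c y t) 1 (Fin.castAdd n q)) =
        (fun r => coeffP k Λ (scaledLeft S c r) (scaledRight S r) (Fin.castAdd n q)) ∘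
          decayFactor S δ ξ k a t := by
      ext y
      rw [(coeff_eq_scaled (δ := δ) (ξ := ξ) (k := k) (a := a) (c := c) (Λ := Λ) S t y).1]
      rfl
    have hder := b3.hasFDerivAt.comp_hasDerivAt z
      (hasDerivAt_decayFactor (δ := δ) (ξ := ξ) (k := k) (a := a) S t z)
    rw [hcomp, hder.deriv]
    have h5 : ‖fun j => (if j ∈ S then -1 else 1) * k j * decayFactor S δ ξ k a t z j‖ ≤
        ‖k‖ * (D * Real.exp (-κ * |z.re|)) := by
      refine (pi_norm_le_iff_of_nonneg (by positivity)).2 fun j => ?_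
      rw [norm_mul, norm_mul]
      have h6 : ‖(if j ∈ S then (-1 : ℂ) else 1)‖ = 1 := by split_ifs <;> simp
      rw [h6, one_mul]
      exact mul_le_mul (norm_le_pi_norm k j) ((norm_le_pi_norm _ j).trans hr) (norm_nonneg _)
        (norm_nonneg _)
    refine (ContinuousLinearMap.le_opNorm _ _).trans ?_
    calc _ ≤ |C| * (‖k‖ * (D * Real.exp (-κ * |z.re|))) :=
          mul_le_mul (b4.trans (le_abs_self C)) h5 (norm_nonneg _) (abs_nonneg _)
      _ ≤ _ := by
          rw [add_mul, ← mul_assoc ‖k‖, ← mul_assoc |C| (‖k‖ * D)]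
          exact le_add_of_nonneg_left (by positivity)

lemma exists_two_sided_decay (hn : 1 ≤ n) (h : MirrorData k Λ c) (t : ℝ) (q : Fin n) :
    ∃ C κ R₀ : ℝ, 0 < κ ∧ ∀ z : ℂ, |z.im| ≤ δ → R₀ ≤ |z.re| →
      (pairMatrix n k Λ (expFactor δ ξ k a c z t) 1).det ≠ 0 ∧
      ‖coeffQ k Λ (expFactor δ ξ k a c z t) 1 (Fin.castAdd n q)‖ ≤ C * Real.exp (-κ * |z.re|) ∧
      ‖deriv (fun y => coeffP k Λ (expFactor δ ξ k a c y t) 1 (Fin.castAdd n q)) z‖ ≤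
        C * Real.exp (-κ * |z.re|) := by
  have : NeZero n := ⟨by omega⟩
  have hre : ∀ i : Fin n, (k (Fin.natAdd n i)).re < 0 := fun i => by
    have h1 := congrArg Complex.re (h.star_K (Fin.castAdd n i))
    rw [mirror_castAdd, Complex.star_def, Complex.conj_re, Complex.neg_re] at h1
    linarith [h.re_K i]
  have hne : ∀ i l : Fin n, Fin.castAdd n i ≠ Fin.natAdd n l := fun i l hil => by
    have := congrArg Fin.val hil
    simp at this
    omega
  -- At the right end the growing exponentials are those with `Re k_j > 0`, the first half of the
  -- indices; at the left end, those of the second half.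
  obtain ⟨C₁, κ₁, R₁, hC₁, hκ₁, h₁⟩ := exists_one_sided_decay (δ := δ) (ξ := ξ) (a := a) h
    (S := Finset.univ.map (Fin.castAddEmb n)) (by simp) (Or.inl rfl)
    (fun j => by
      refine Fin.addCases (fun i => ?_) (fun i => ?_) j
      · rw [if_pos (by simp)]
        linarith [h.re_K i]
      · rw [if_neg]
        · linarith [hre i]
        · simp only [Finset.mem_map, Finset.mem_univ, true_and, not_exists]
          exact fun l => hne l i) t q
  obtain ⟨C₂, κ₂, R₂, hC₂, hκ₂, h₂⟩ := exists_one_sided_decay (δ := δ) (ξ := ξ) (a := a) h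
    (S := Finset.univ.map (Fin.natAddEmb n)) (by simp) (Or.inr rfl)
    (fun j => by
      refine Fin.addCases (fun i => ?_) (fun i => ?_) j
      · rw [if_neg]
        · linarith [h.re_K i]
        · simp only [Finset.mem_map, Finset.mem_univ, true_and, not_exists]
          exact fun l hl => hne i l hl.symm
      · rw [if_pos (show Fin.natAdd n i ∈ _ from
          Finset.mem_map_of_mem (Fin.natAddEmb n) (Finset.mem_univ i))]
        linarith [hre i]) t q
  have hmono : ∀ {C κ x : ℝ}, 0 ≤ C → C ≤ max C₁ C₂ → min κ₁ κ₂ ≤ κ →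
      C * Real.exp (-κ * |x|) ≤ max C₁ C₂ * Real.exp (-(min κ₁ κ₂) * |x|) := by
    intro C κ x h0 h1 h2
    refine mul_le_mul h1 (Real.exp_le_exp.2 ?_) (Real.exp_pos _).le (h0.trans h1)
    exact mul_le_mul_of_nonneg_right (neg_le_neg h2) (abs_nonneg _)
  refine ⟨max C₁ C₂, min κ₁ κ₂, max R₁ R₂, lt_min hκ₁ hκ₂, fun z hz hR => ?_⟩
  rcases le_total 0 z.re with h0 | h0
  · obtain ⟨b1, b2, b3⟩ := h₁ z hz (by linarith) ((le_max_left _ _).trans hR)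
    exact ⟨b1, b2.trans (hmono hC₁ (le_max_left _ _) (min_le_left _ _)),
      b3.trans (hmono hC₁ (le_max_left _ _) (min_le_left _ _))⟩
  · obtain ⟨b1, b2, b3⟩ := h₂ z hz (by linarith) ((le_max_right _ _).trans hR)
    exact ⟨b1, b2.trans (hmono hC₂ (le_max_right _ _) (min_le_right _ _)),
      b3.trans (hmono hC₂ (le_max_right _ _) (min_le_right _ _))⟩

end

end INLS

/-! ### From the algebra to the nonlocal equation -/

namespace INLS

noncomputable section

open Polynomial Matrix

variable {n : ℕ} {δ ξ : ℝ} {k a c : Fin (n + n) → ℂ}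

lemma star_phase (k a x : ℂ) (t : ℝ) :
    star (phase δ ξ k a x t) = -phase δ ξ (-star k) (-star a) (star x) t := by
  have h := star_bigL (δ := δ) k
  simp only [Complex.star_def] at h
  simp only [phase, Complex.star_def, map_add, map_mul, map_sub, map_pow, Complex.conj_I,
    Complex.conj_ofReal, h]
  ring

lemma SolitonParameters.star_phase_mirror (h : SolitonParameters δ k a c) (j : Fin (n + n))
    (x : ℂ) (t : ℝ) : star (phase δ ξ (k (mirror j)) (a (mirror j)) x t) =
      -phase δ ξ (k j) (a j) (star x) t := by
  rw [star_phase, h.star_k, h.star_a, mirror_mirror, neg_neg, neg_neg]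

/-- The shift by `-2iδ` multiplies the exponential by `e^{-2iδk}`, and `L` is defined so that this
equals `1 - iL`. -/
lemma expFactor_shift (x : ℂ) (t : ℝ) (j : Fin (n + n)) :
    expFactor δ ξ k a c (x - 2 * δ * Complex.I) t j =
      (1 - Complex.I * bigL δ (k j)) * expFactor δ ξ k a c x t j := by
  have h1 : phase δ ξ (k j) (a j) (x - 2 * δ * Complex.I) t =
      -2 * Complex.I * δ * k j + phase δ ξ (k j) (a j) x t := by
    rw [phase, phase]; ring
  rw [expFactor, expFactor, h1, Complex.exp_add, bigL]
  linear_combination (c j * Complex.exp (phase δ ξ (k j) (a j) x t) *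
    (Complex.exp (-2 * Complex.I * δ * k j) - 1)) * Complex.I_mul_I

/-- By the symmetry, `e^{λ_j} conj(e^{λ_{n+j}}) = exp(λ_j(y) - λ_j(conj y))`. Everything real
cancels and the twist `e^{2i k_j Im y}` remains. -/
lemma SolitonParameters.det_ne_zero (hδ : 0 < δ) (h : SolitonParameters δ k a c) {y : ℂ}
    (hg : ∀ α : Fin n → ℂ, α ≠ 0 → 0 < (star α ⬝ᵥ (cauchyGram (fun i => k (Fin.castAdd n i)) *ᵥ
      fun j => Complex.exp (2 * Complex.I * (y.im : ℝ) * k (Fin.castAdd n j)) * α j)).re) (t : ℝ) :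
    (pairMatrix n k (fun j => bigL δ (k j)) (expFactor δ ξ k a c y t) 1).det ≠ 0 := by
  refine det_pairMatrix_ne_zero_of_twisted (h.mirrorData hδ) hg
    (e := fun j => Complex.exp (phase δ ξ (k j) (a j) y t)) fun i => ?_
  have h1 := h.star_phase_mirror (ξ := ξ) (Fin.castAdd n i) y t
  rw [mirror_castAdd] at h1
  rw [Complex.star_def, ← Complex.exp_conj, ← Complex.star_def, h1, ← Complex.exp_add]
  congr 1
  have h2 : y - star y = 2 * Complex.I * (y.im : ℝ) := by
    rw [Complex.star_def, Complex.sub_conj]; push_cast; ring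
  rw [phase, phase]
  linear_combination (k (Fin.castAdd n i)) * h2

lemma SolitonParameters.star_coeffQ (hn : 1 ≤ n) (hδ : 0 < δ) (h : SolitonParameters δ k a c)
    {x : ℂ} {t : ℝ}
    (hx : (pairMatrix n k (fun j => bigL δ (k j)) (expFactor δ ξ k a c x t) 1).det ≠ 0)
    (hx' : (pairMatrix n k (fun j => bigL δ (k j)) (expFactor δ ξ k a c (star x) t) 1).det ≠ 0) :
    star (coeffQ k (fun j => bigL δ (k j)) (expFactor δ ξ k a c x t) 1
      (Fin.castAdd n ⟨n - 1, by omega⟩)) =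
    coeffP k (fun j => bigL δ (k j)) (expFactor δ ξ k a c (star x) t) 1
      (Fin.natAdd n ⟨n - 1, by omega⟩) := by
  have key := star_coeff_eq hn (h.mirrorData hδ)
    (e := fun j => Complex.exp (phase δ ξ (k j) (a j) x t))
    (e' := fun j => Complex.exp (phase δ ξ (k j) (a j) (star x) t)) (fun j => by
      rw [Complex.star_def, ← Complex.exp_conj, ← Complex.star_def, h.star_phase_mirror,
        ← Complex.exp_add, add_neg_cancel, Complex.exp_zero])
    (degree_ofCoeffs_lt _) (degree_ofCoeffs_lt _) (degree_ofCoeffs_lt _) (degree_ofCoeffs_lt _)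
    (fun j => by
      have := coeffQ_spec hx j
      rw [Pi.one_apply, mul_one] at this
      exact this)
    (fun j => by
      have := coeffP_spec hx' j
      rw [Pi.one_apply, mul_one] at this
      exact this)
  have hc := coeff_ofCoeffs (fun q => coeffQ k (fun j => bigL δ (k j))
    (expFactor δ ξ k a c x t) 1 (Fin.castAdd n q)) ⟨n - 1, by omega⟩
  have hc' := coeff_ofCoeffs (fun q => coeffP k (fun j => bigL δ (k j))
    (expFactor δ ξ k a c (star x) t) 1 (Fin.natAdd n q)) ⟨n - 1, by omega⟩
  rw [← hc, ← hc']
  exact key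

lemma tendsto_exp_neg_mul_abs {κ : ℝ} (hκ : 0 < κ) (C : ℝ) {l : Filter ℝ}
    (hl : Tendsto (fun x : ℝ => |x|) l atTop) :
    Tendsto (fun x : ℝ => C * Real.exp (-κ * |x|)) l (𝓝 0) := by
  have : Tendsto (fun x : ℝ => -κ * |x|) l atBot := hl.const_mul_atTop_of_neg (neg_lt_zero.2 hκ)
  simpa using (Real.tendsto_exp_atBot.comp this).const_mul C

lemma SolitonParameters.tendsto_w21 (hn : 1 ≤ n) (hδ : 0 < δ) (h : SolitonParameters δ k a c)
    (t : ℝ) {l : Filter ℝ} (hl : Tendsto (fun x : ℝ => |x|) l atTop) :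
    Tendsto (fun x : ℝ => w21 δ ξ k a c ((x : ℂ) - Complex.I * δ) t) l (𝓝 0) := by
  obtain ⟨C, κ, R₀, hκ, hb⟩ := exists_two_sided_decay (δ := δ) (ξ := ξ) (a := a) hn
    (h.mirrorData hδ) t ⟨n - 1, by omega⟩
  refine squeeze_zero_norm' ?_ (tendsto_exp_neg_mul_abs hκ C hl)
  filter_upwards [hl.eventually_ge_atTop R₀] with x hx
  have := (hb ((x : ℂ) - Complex.I * δ) (by simp [abs_of_pos hδ]) (by simpa using hx)).2.1
  rw [w21_eq δ ξ k a c hn]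
  simpa using this

lemma analyticityCondition_w21 (hn : 1 ≤ n) (hδ : 0 < δ) (h : SolitonParameters δ k a c)
    (hdet : ∀ (t : ℝ) (y : ℂ), |y.im| ≤ δ →
      (pairMatrix n k (fun j => bigL δ (k j)) (expFactor δ ξ k a c y t) 1).det ≠ 0) (t : ℝ) :
    AnalyticityCondition δ fun z : ℂ => w21 δ ξ k a c (z - Complex.I * δ) t := by
  simp only [w21_eq δ ξ k a c hn]
  have hstrip : ∀ z : ℂ, 0 ≤ z.im → z.im ≤ 2 * δ → |(z - Complex.I * δ).im| ≤ δ := by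
    intro z h0 h1
    rw [abs_le]
    simp
    constructor <;> linarith
  have han : AnalyticOnNhd ℂ (fun z : ℂ => coeffQ k (fun j => bigL δ (k j))
      (expFactor δ ξ k a c (z - Complex.I * δ) t) 1 (Fin.castAdd n ⟨n - 1, by omega⟩))
      {z | 0 ≤ z.im ∧ z.im ≤ 2 * δ} := by
    intro z hz
    rw [Complex.analyticAt_iff_eventually_differentiableAt]
    have hcont : ContinuousAt (fun z : ℂ => z - Complex.I * δ) z := by fun_prop
    filter_upwards [hcont.preimage_mem_nhds ((isOpen_det_ne_zero _ t).mem_nhds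
      (hdet t _ (hstrip z hz.1 hz.2)))] with w hw
    have hd : DifferentiableAt ℂ (fun y => coeffQ k (fun j => bigL δ (k j))
        (expFactor δ ξ k a c y t) 1 (Fin.castAdd n ⟨n - 1, by omega⟩)) (w - Complex.I * δ) :=
      differentiableAt_coeffQ hw _
    exact hd.comp (f := fun z : ℂ => z - Complex.I * δ) w (by fun_prop)
  refine ⟨han, ?_⟩
  obtain ⟨C, κ, R₀, hκ, hb⟩ := exists_two_sided_decay (δ := δ) (ξ := ξ) (a := a) hn
    (h.mirrorData hδ) t ⟨n - 1, by omega⟩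
  refine integrable_of_continuous_of_exp_decay (C := C) (R₀ := R₀) ?_ hκ fun x hx => ?_
  · refine continuous_iff_continuousAt.2 fun x => ?_
    exact ContinuousAt.comp (f := fun x : ℝ => (x : ℂ))
      (han x ⟨by simp, by simp [hδ.le]⟩).continuousAt Complex.continuous_ofReal.continuousAt
  · have := (hb ((x : ℂ) - Complex.I * δ) (by simp [abs_of_pos hδ]) (by simpa using hx)).2.1
    simpa using this

/-- `shift_relation` between the lines `Im = δ` and `Im = -δ` expresses the difference of the
`coeffP` coefficients by a product of two factors, which `star_coeffQ` identifies as `u` and its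
conjugate. -/
lemma normSq_w21 (hn : 1 ≤ n) (hδ : 0 < δ) (h : SolitonParameters δ k a c)
    (hdet : ∀ (t : ℝ) (y : ℂ), |y.im| ≤ δ →
      (pairMatrix n k (fun j => bigL δ (k j)) (expFactor δ ξ k a c y t) 1).det ≠ 0) (x t : ℝ) :
    ((‖w21 δ ξ k a c ((x : ℂ) - Complex.I * δ) t‖ ^ 2 : ℝ) : ℂ) =
      -Complex.I * coeffP k (fun j => bigL δ (k j))
        (expFactor δ ξ k a c ((x : ℂ) - Complex.I * δ) t) 1 (Fin.castAdd n ⟨n - 1, by omega⟩) -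
      -Complex.I * coeffP k (fun j => bigL δ (k j))
        (expFactor δ ξ k a c ((x : ℂ) + 2 * δ * Complex.I - Complex.I * δ) t) 1
          (Fin.castAdd n ⟨n - 1, by omega⟩) := by
  have h1 : (x : ℂ) + 2 * δ * Complex.I - Complex.I * δ = x + Complex.I * δ := by ring
  have h2 : star ((x : ℂ) - Complex.I * δ) = x + Complex.I * δ := by simp
  have h3 : (x : ℂ) - Complex.I * δ = (x + Complex.I * δ) - 2 * δ * Complex.I := by ring
  have d1 := hdet t ((x : ℂ) - Complex.I * δ) (by simp [abs_of_pos hδ])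
  have d2 := hdet t ((x : ℂ) + Complex.I * δ) (by simp [abs_of_pos hδ])
  have hs := shift_relation hn (E' := expFactor δ ξ k a c ((x : ℂ) - Complex.I * δ) t)
    (fun j => by rw [h3]; exact expFactor_shift (δ := δ) (x + Complex.I * δ) t j) d2 d1
    ⟨n - 1, by omega⟩
  have hc := h.star_coeffQ hn hδ d1 (by rw [h2]; exact d2)
  rw [h2] at hc
  rw [h1, w21_eq δ ξ k a c hn]
  push_cast
  rw [← Complex.conj_mul', ← Complex.star_def, hc]
  generalize coeffP k (fun j => bigL δ (k j)) (expFactor δ ξ k a c (x + Complex.I * δ) t) 1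
    (Fin.natAdd n ⟨n - 1, by omega⟩) = w at *
  linear_combination (-Complex.I) * hs + (w * coeffQ k (fun j => bigL δ (k j))
    (expFactor δ ξ k a c ((x : ℂ) - Complex.I * δ) t) 1 (Fin.castAdd n ⟨n - 1, by omega⟩)) *
    Complex.I_mul_I

lemma isSolution_w21 (hn : 1 ≤ n) (hδ : 0 < δ) (h : SolitonParameters δ k a c)
    (hdet : ∀ (t : ℝ) (y : ℂ), |y.im| ≤ δ →
      (pairMatrix n k (fun j => bigL δ (k j)) (expFactor δ ξ k a c y t) 1).det ≠ 0) :
    IsSolution δ fun x t : ℝ => w21 δ ξ k a c ((x : ℂ) - Complex.I * δ) t := by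
  set top : Fin n := ⟨n - 1, by omega⟩ with htop
  set Q : ℂ → ℝ → ℂ := fun y t => coeffQ k (fun j => bigL δ (k j)) (expFactor δ ξ k a c y t) 1
    (Fin.castAdd n top) with hQ
  set P : ℂ → ℝ → ℂ := fun y t => coeffP k (fun j => bigL δ (k j)) (expFactor δ ξ k a c y t) 1
    (Fin.castAdd n top) with hP
  -- Chosen so that `(|u|²)_x = F(x) - F(x + 2iδ)`, the form to which `exists_hasT` applies.
  set F : ℝ → ℂ → ℂ := fun t z => -Complex.I * deriv (fun y => P y t) (z - Complex.I * δ) with hF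
  have hstrip : ∀ z : ℂ, 0 ≤ z.im → z.im ≤ 2 * δ → |(z - Complex.I * δ).im| ≤ δ := by
    intro z h0 h1
    rw [abs_le]
    simp
    constructor <;> linarith
  have hFd : ∀ t : ℝ, ∀ z : ℂ, 0 ≤ z.im → z.im ≤ 2 * δ → DifferentiableAt ℂ (F t) z := by
    intro t z h0 h1
    have hU := isOpen_det_ne_zero (δ := δ) (ξ := ξ) (k := k) (a := a) (c := c)
      (fun j => bigL δ (k j)) t
    have hPU : DifferentiableOn ℂ (fun y => P y t) {y | (pairMatrix n k (fun j => bigL δ (k j))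
        (expFactor δ ξ k a c y t) 1).det ≠ 0} :=
      fun y hy => (differentiableAt_coeffP hy _).differentiableWithinAt
    have h2 := (hPU.deriv hU).differentiableAt (hU.mem_nhds (hdet t _ (hstrip z h0 h1)))
    have h3 : DifferentiableAt ℂ (fun z : ℂ => deriv (fun y => P y t) (z - Complex.I * δ)) z :=
      DifferentiableAt.comp (f := fun z : ℂ => z - Complex.I * δ) z h2 (by fun_prop)
    exact h3.const_mul _
  have hFdecay : ∀ t, StripDecay δ (F t) := by
    intro t
    obtain ⟨C, κ, R₀, hκ, hb⟩ := exists_two_sided_decay (δ := δ) (ξ := ξ) (a := a) hn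
      (h.mirrorData hδ) t top
    refine ⟨C, κ, R₀, hκ, fun z h0 h1 hR => ?_⟩
    have := (hb (z - Complex.I * δ) (hstrip z h0 h1) (by simpa using hR)).2.2
    rw [hF]
    simp only [norm_mul, norm_neg, Complex.norm_I, one_mul]
    simpa using this
  have hline : ∀ x : ℝ, |((x : ℂ) - Complex.I * δ).im| ≤ δ := fun x => by simp [abs_of_pos hδ]
  have hPder : ∀ t : ℝ, ∀ z : ℂ, 0 ≤ z.im → z.im ≤ 2 * δ →
      HasDerivAt (fun z => -Complex.I * P (z - Complex.I * δ) t) (F t z) z := by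
    intro t z h0 h1
    have h2 : HasDerivAt (fun y => P y t) _ (z - Complex.I * δ) :=
      (differentiableAt_coeffP (hdet t _ (hstrip z h0 h1)) _).hasDerivAt
    exact (h2.comp_sub_const z (Complex.I * δ)).const_mul _
  have hrhoC : ∀ t x : ℝ, HasDerivAt
      (fun y : ℝ => ((‖w21 δ ξ k a c ((y : ℂ) - Complex.I * δ) t‖ ^ 2 : ℝ) : ℂ))
      (F t x - F t (x + 2 * δ * Complex.I)) x := by
    intro t x
    have h1 := (hPder t x (by simp) (by simp [hδ.le])).comp_ofReal
    have h2 := ((hPder t (x + 2 * δ * Complex.I) (by simp [hδ.le]) (by simp)).comp_add_const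
      (x : ℂ) (2 * δ * Complex.I)).comp_ofReal
    refine (h1.sub h2).congr_of_eventuallyEq (Eventually.of_forall fun y => ?_)
    exact normSq_w21 hn hδ h hdet y t
  set rhox : ℝ → ℝ → ℝ := fun x t => (F t x - F t (x + 2 * δ * Complex.I)).re with hrhox
  have hrho : ∀ x t : ℝ, HasDerivAt
      (fun y : ℝ => ‖w21 δ ξ k a c ((y : ℂ) - Complex.I * δ) t‖ ^ 2) (rhox x t) x := by
    intro x t
    have := Complex.reCLM.hasFDerivAt.comp_hasDerivAt x (hrhoC t x)
    exact this
  have hrhoeq : ∀ x t : ℝ, (rhox x t : ℂ) = F t x - F t (x + 2 * δ * Complex.I) := fun x t =>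
    (hrho x t).ofReal_comp.unique (hrhoC t x)
  have hT := fun x t : ℝ => exists_hasT hδ (hFd t) (hFdecay t) (f := fun y => rhox y t)
    (fun r => hrhoeq r t) x
  choose Trhox hT1 hT2 using hT
  refine ⟨fun x t => deriv (fun s => Q (x - Complex.I * δ) s) t,
    fun x t => deriv (fun y => Q y t) (x - Complex.I * δ),
    fun x t => deriv (deriv fun y => Q y t) (x - Complex.I * δ), rhox, Trhox, fun x t => ?_⟩
  have hd := hdet t _ (hline x)
  refine ⟨?_, ?_, ?_, hrho x t, hT1 x t, ?_⟩
  · simp only [w21_eq δ ξ k a c hn]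
    exact (differentiableAt_coeffQ_time hd _).hasDerivAt
  · simp only [w21_eq δ ξ k a c hn]
    have h1 : HasDerivAt (fun y => Q y t) _ ((x : ℂ) - Complex.I * δ) :=
      (differentiableAt_coeffQ hd _).hasDerivAt
    exact (h1.comp_sub_const (x : ℂ) (Complex.I * δ)).comp_ofReal
  · have h1 : HasDerivAt (deriv fun y => Q y t) _ ((x : ℂ) - Complex.I * δ) :=
      (differentiableAt_deriv_coeffQ hd _).hasDerivAt
    exact (h1.comp_sub_const (x : ℂ) (Complex.I * δ)).comp_ofReal
  · have hev := evolution_equation hn hd top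
    simp only
    rw [hT2, hrhoeq, w21_eq δ ξ k a c hn]
    change deriv (fun s => Q (x - Complex.I * δ) s) t + Complex.I *
      deriv (deriv fun y => Q y t) (x - Complex.I * δ) - 2 * Complex.I * Q (x - Complex.I * δ) t *
        deriv (fun y => P y t) (x - Complex.I * δ) = 0 at hev
    change _ = _ - Q (x - Complex.I * δ) t * _
    have hFx : F t x = -Complex.I * deriv (fun y => P y t) (x - Complex.I * δ) := rfl
    -- In `T + i` the values on the upper line cancel. This is what turns the nonlocal term into the
    -- local term `2 p_x` of the evolution equation.
    have e : Complex.I * (F t x + F t (x + 2 * δ * Complex.I)) +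
        Complex.I * (F t x - F t (x + 2 * δ * Complex.I)) =
        2 * deriv (fun y => P y t) (x - Complex.I * δ) := by
      rw [hFx]
      linear_combination (-2 * deriv (fun y => P y t) (x - Complex.I * δ)) * Complex.I_mul_I
    rw [e]
    linear_combination Complex.I * hev - (deriv (deriv fun y => Q y t) (x - Complex.I * δ) -
      2 * Q (x - Complex.I * δ) t * deriv (fun y => P y t) (x - Complex.I * δ)) * Complex.I_mul_I

end

end INLS

theorem proposition4p1 (n : ℕ) (hn : 1 ≤ n) (δ : ℝ) (hδ : 0 < δ) :
    ∃ ε : ℝ, 0 < ε ∧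
      ∀ (k a c : Fin (n + n) → ℂ) (ξ : ℝ), INLS.SolitonParameters δ k a c →
        (∀ t : ℝ,
          Tendsto (fun x : ℝ => INLS.w21 δ ξ k a c ((x : ℂ) - Complex.I * δ) t) atTop (𝓝 0) ∧
          Tendsto (fun x : ℝ => INLS.w21 δ ξ k a c ((x : ℂ) - Complex.I * δ) t) atBot (𝓝 0)) ∧
        ((∀ j, ‖k j‖ < ε) →
          (∀ t : ℝ, ∀ z : ℂ, 0 ≤ z.im → z.im ≤ 2 * δ →
            INLS.tau δ ξ k a c (z - Complex.I * δ) t ≠ 0) ∧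
          (∀ t : ℝ, INLS.AnalyticityCondition δ
            (fun z : ℂ => INLS.w21 δ ξ k a c (z - Complex.I * δ) t)) ∧
          INLS.IsSolution δ
            (fun x t : ℝ => INLS.w21 δ ξ k a c ((x : ℂ) - Complex.I * δ) t)) := by
  obtain ⟨ε, hε, hpos⟩ := INLS.exists_twisted_cauchy_re_pos n δ hδ
  refine ⟨ε, hε, fun k a c ξ h => ⟨fun t => ⟨h.tendsto_w21 hn hδ t tendsto_abs_atTop_atTop,
    h.tendsto_w21 hn hδ t tendsto_abs_atBot_atTop⟩, fun hk => ?_⟩⟩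
  -- The strip `0 ≤ Im z ≤ 2δ` shifted by `-iδ` becomes `|Im y| ≤ δ`, exactly the range of twists
  -- covered by `ε`.
  have hdet : ∀ (t : ℝ) (y : ℂ), |y.im| ≤ δ → (INLS.pairMatrix n k
      (fun j => INLS.bigL δ (k j)) (INLS.expFactor δ ξ k a c y t) 1).det ≠ 0 := fun t y hy =>
    h.det_ne_zero hδ (hpos (fun i => k (Fin.castAdd n i))
      (fun _ _ hij => Fin.castAdd_injective n n (h.k_inj hij)) h.re_pos (fun i => hk _) y.im hy) t
  refine ⟨fun t z h0 h1 => ?_, fun t => INLS.analyticityCondition_w21 hn hδ h hdet t,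
    INLS.isSolution_w21 hn hδ h hdet⟩
  rw [INLS.tau_eq]
  refine hdet t _ (abs_le.2 ?_)
  simp
  constructor <;> linarith
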